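/- All graphs are finite and simple, except where a new edge is added in (iv) below. A snark is a (connected) bridgeless cubic graph that is cyclically $4$-edge-connected (deleting fewer than four edges never leaves two components each containing a cycle), has edge chromatic number four, and has girth at least five. A $2$-factor of a graph is a $2$-regular spanning subgraph; it is odd if all its cycles have odd length. A graph is odd $2$-factored if all its $2$-factors are odd. An edge $xy$ of a snark $L$ is a bold-edge if (i) all $2$-factors of $L-x$ and of $L-y$ are odd; (ii) all $2$-factors of $L$ containing $xy$ are odd; (iii) all $2$-factors of $L$ avoiding $xy$ are odd. Two independent edges $f=ab$, $g=cd$ of a snark $R$ form a gadget-pair if (i) no $2$-factor of $R$ avoids both $f$ and $g$; (ii) all $2$-factors of $R$ containing exactly one of $f,g$ are odd; (iii) all $2$-factors of $R$ containing both $f$ and $g$ are odd, and $f,g$ lie in different cycles of each such $2$-factor; (iv) in every $2$-factor of $(R-\{f,g\})\cup\{ac,ad,bc,bd\}$ containing exactly one of the four new edges $ac,ad,bc,bd$, the cycle containing the new edge has even length and all other cycles have odd length (here a new edge is distinct from the edges of $R$; if its ends are already adjacent in $R$ it is a parallel edge, and two parallel edges form a cycle of length two). For an edge $xy$ of $L$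 with $N(x)\setminus\{y\}=\{r,s\}$ and $N(y)\setminus\{x\}=\{t,u\}$, and independent edges $ab,cd$ of $R$, the dot product $L\cdot R$ is obtained from the disjoint union of $L-\{x,y\}$ and $R-\{ab,cd\}$ by adding two edges that match $\{r,s\}$ with one of $\{a,b\},\{c,d\}$ and two edges that match $\{t,u\}$ with the other; any of the resulting graphs is allowed. **Theorem 3.1.** Let $xy$ be a bold-edge in a snark $L$ and let $\{ab,cd\}$ be a gadget-pair in a snark $R$. Then every dot product $L\cdot R$ built from these edges is a snark and is odd $2$-factored: every cycle of every $2$-factor of $L\cdot R$ has odd length. -/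

import Mathlib

namespace BoldGadget

/-- `F` is a `2`-factor of `G`: a spanning subgraph in which every vertex has degree two. -/
def IsTwoFactor {V : Type*} (G F : SimpleGraph V) : Prop :=
  F ≤ G ∧ ∀ v, (F.neighborSet v).ncard = 2

/-- Every cycle of `F` has odd length (for a `2`-factor: `F` is odd). -/
def IsOdd {V : Type*} (F : SimpleGraph V) : Prop :=
  ∀ (v : V) (C : F.Walk v v), C.IsCycle → Odd C.length

/-- Every cycle of every `2`-factor of `G` is odd. -/
def IsOddTwoFactored {V : Type*} (G : SimpleGraph V) : Prop :=
  ∀ F, IsTwoFactor G F → IsOdd F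

/-- `G` is cyclically `k`-edge-connected: deleting fewer than `k` edges never leaves two
components that both contain a cycle. -/
def IsCyclicallyEdgeConnected {V : Type*} (G : SimpleGraph V) (k : ℕ) : Prop :=
  ∀ S : Set (Sym2 V), S ⊆ G.edgeSet → S.encard < k →
    ∀ (u v : V) (C : (G.deleteEdges S).Walk u u) (D : (G.deleteEdges S).Walk v v),
      C.IsCycle → D.IsCycle → (G.deleteEdges S).Reachable u v

/-- A snark: a connected bridgeless cubic graph, cyclically `4`-edge-connected, with edge
chromatic number four and girth at least five. It is used for finite graphs only. -/
structure IsSnark {V : Type*} (G : SimpleGraph V) : Prop where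
  connected : G.Connected
  cubic : ∀ v, (G.neighborSet v).ncard = 3
  bridgeless : ∀ e ∈ G.edgeSet, ¬ G.IsBridge e
  cyclically_four_edge_connected : IsCyclicallyEdgeConnected G 4
  edge_chromatic_number : G.lineGraph.chromaticNumber = 4
  girth : 5 ≤ G.egirth

/-- The edge `xy` is a bold-edge of `L`. The graph `L - v` is the induced subgraph
`L.induce {v}ᶜ`. -/
structure IsBoldEdge {V : Type*} (L : SimpleGraph V) (x y : V) : Prop where
  adj : L.Adj x y
  odd_delete_left : ∀ F, IsTwoFactor (L.induce {x}ᶜ) F → IsOdd F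
  odd_delete_right : ∀ F, IsTwoFactor (L.induce {y}ᶜ) F → IsOdd F
  odd_containing : ∀ F, IsTwoFactor L F → F.Adj x y → IsOdd F
  odd_avoiding : ∀ F, IsTwoFactor L F → ¬ F.Adj x y → IsOdd F

/-- `H` together with one *new* edge `pq` is a `2`-factor of the (multi)graph obtained from `G` by
adding new edges. The new edge is not an edge of `G`, even when `p` and `q` are already
adjacent in `G` (it is then a parallel edge). Here `H` is the set of the edges of the `2`-factor
that belong to `G`, so `p` and `q` have degree one in `H` and the new edge raises it to two. -/
def IsTwoFactorWithNewEdge {V : Type*} (G H : SimpleGraph V) (p q : V) : Prop :=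
  H ≤ G ∧ (H.neighborSet p).ncard = 1 ∧ (H.neighborSet q).ncard = 1 ∧
    ∀ v, v ≠ p → v ≠ q → (H.neighborSet v).ncard = 2

/-- The edges `f = ab` and `g = cd` form a gadget-pair of `R`.

In the last two conditions `H` together with a new edge `pq`, where `pq` is one of
`ac, ad, bc, bd`, is a `2`-factor of `(R - {f, g}) ∪ {ac, ad, bc, bd}` which contains exactly one
of the four new edges. Its cycle through the new edge consists of the new edge and a
path of `H` from `p` to `q`, and its other cycles are the cycles of `H`. -/
structure IsGadgetPair {V : Type*} (R : SimpleGraph V) (a b c d : V) : Prop where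
  adj_left : R.Adj a b
  adj_right : R.Adj c d
  independent : a ≠ c ∧ a ≠ d ∧ b ≠ c ∧ b ≠ d
  not_avoiding : ¬ ∃ F, IsTwoFactor R F ∧ ¬ F.Adj a b ∧ ¬ F.Adj c d
  odd_one : ∀ F, IsTwoFactor R F →
    (F.Adj a b ∧ ¬ F.Adj c d ∨ ¬ F.Adj a b ∧ F.Adj c d) → IsOdd F
  odd_both : ∀ F, IsTwoFactor R F → F.Adj a b → F.Adj c d → IsOdd F
  different_cycles : ∀ F, IsTwoFactor R F → F.Adj a b → F.Adj c d →
    ∀ (v : V) (C : F.Walk v v), C.IsCycle → ¬ (s(a, b) ∈ C.edges ∧ s(c, d) ∈ C.edges)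
  even_new : ∀ p q, (p = a ∨ p = b) → (q = c ∨ q = d) →
    ∀ H, IsTwoFactorWithNewEdge (R.deleteEdges {s(a, b), s(c, d)}) H p q →
      ∀ P : H.Walk p q, P.IsPath → Even (P.length + 1)
  odd_old : ∀ p q, (p = a ∨ p = b) → (q = c ∨ q = d) →
    ∀ H, IsTwoFactorWithNewEdge (R.deleteEdges {s(a, b), s(c, d)}) H p q → IsOdd H

/-- The four new edges `ra, sb, tc, ud` of the dot product. -/
def joiningEdges {V W : Type*} (x y r s t u : V) (a b c d : W) :
    SimpleGraph (({x, y}ᶜ : Set V) ⊕ W) :=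
  SimpleGraph.fromRel fun m n => ∃ (v : ({x, y}ᶜ : Set V)) (w : W), m = Sum.inl v ∧ n = Sum.inr w ∧
    ((v : V) = r ∧ w = a ∨ (v : V) = s ∧ w = b ∨ (v : V) = t ∧ w = c ∨ (v : V) = u ∧ w = d)

/-- The dot product `L · R`: remove from `L` the adjacent vertices `x` and `y`, whose other
neighbours are `r, s` and `t, u` respectively, remove from `R` the edges `ab` and `cd`,
and join `r` to `a`, `s` to `b`, `t` to `c` and `u` to `d`. All the ways to join
`{r, s}` and `{t, u}` to `{a, b}` and `{c, d}` arise by renaming `r, s, t, u, a, b, c, d`. -/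
def dotProduct {V W : Type*} (L : SimpleGraph V) (x y r s t u : V)
    (R : SimpleGraph W) (a b c d : W) : SimpleGraph (({x, y}ᶜ : Set V) ⊕ W) :=
  ((L.induce {x, y}ᶜ).sum (R.deleteEdges {s(a, b), s(c, d)})) ⊔ joiningEdges x y r s t u a b c d

end BoldGadget

/-! ### Component sizes as a substitute for cycle lengths -/

namespace BoldGadget

open SimpleGraph

variable {U : Type*}

/-! The cycles of a 2-factor are its components, so a 2-factor is odd exactly when every component
has an odd number of vertices (`AllOdd`). Unlike cycle length, this notion survives when the graph
is cut into paths and isolated vertices, and it changes predictably when an edge is added.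

A 2-factor of the dot product, viewed on `V ⊕ W` with `x` and `y` isolated, consists of a trace `Q`
in `L`, a trace `P` in `R` and some of the joining edges `ra`, `sb`, `tc`, `ud`. Handshaking in `Q`
makes the number of joining edges even, which leaves four cases up to symmetry. None used: `P` is a
2-factor of `R` avoiding both gadget edges, which is excluded. `ra`, `sb` used: `Q` with the path `r
x s` is a 2-factor of `L - y`, so `r` lies on a path of `Q` with evenly many vertices; `P` with `ab`
is a 2-factor of `R`, so the `a`-`b` path has oddly many; the glued cycle is odd
(`allOdd_of_same_side`). `ra`, `tc` used: `Q` with `r x y t` is a 2-factor of `L` containing `xy`,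
so the `r`-`t` path is odd; condition (iv) makes the `a`-`c` path even (`allOdd_of_both_sides`). All
four used: by (iii), `P` has disjoint odd paths `a`-`b` and `c`-`d`. They replace the vertices `x`
and `y` of a 2-factor of `L` avoiding `xy`, and replacing one vertex by an odd path preserves parity
(`allOdd_of_four`).

For the snark property, connectedness, bridgelessness and cyclic connectivity all follow, in a cubic
graph, from one condition on cuts, `HasOnlyTrivialThreeCuts`, which passes from `L` and `R` to the
dot product by counting. A 3-edge-colouring would yield a 2-factor with only even cycles, so oddness
itself rules it out; a 4-edge-colouring comes from a Brooks-type greedy colouring of the line graph.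
-/

/-- The number of neighbours of a vertex. -/
noncomputable def valency (K : SimpleGraph U) (v : U) : ℕ := (K.neighborSet v).ncard

/-- The number of vertices of the component of a vertex. -/
noncomputable def compCard (K : SimpleGraph U) (v : U) : ℕ := {w | K.Reachable v w}.ncard

/-- Every component has an odd number of vertices. -/
def AllOdd (K : SimpleGraph U) : Prop := ∀ v, Odd (compCard K v)

theorem mem_of_reachable {K : SimpleGraph U} {S : Set U}
    (hS : ∀ v ∈ S, ∀ w, K.Adj v w → w ∈ S) {v w : U} (hv : v ∈ S) (h : K.Reachable v w) :
    w ∈ S := by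
  obtain ⟨p⟩ := h
  induction p with
  | nil => exact hv
  | cons h _ ih => exact ih (hS _ hv _ h)

theorem compCard_congr {K : SimpleGraph U} {v w : U} (h : K.Reachable v w) :
    compCard K v = compCard K w := by
  unfold compCard
  congr 1
  ext z
  exact ⟨fun hz => h.symm.trans hz, fun hz => h.trans hz⟩

theorem compCard_eq_one {K : SimpleGraph U} {v : U} (h : ∀ w, ¬ K.Adj v w) :
    compCard K v = 1 := by
  unfold compCard
  rw [Set.ncard_eq_one]
  refine ⟨v, Set.eq_singleton_iff_unique_mem.2 ⟨Reachable.refl v, fun w hw => ?_⟩⟩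
  have := mem_of_reachable (K := K) (S := {v}) (by rintro _ rfl w hw; exact (h w hw).elim) rfl hw
  simpa using this

theorem degree_eq_valency (K : SimpleGraph U) (v : U) [Fintype (K.neighborSet v)] :
    K.degree v = valency K v := by
  unfold valency
  rw [Set.ncard_eq_toFinset_card', ← SimpleGraph.neighborFinset_def, card_neighborFinset_eq_degree]

/-- The part of a graph in the component of `v`. -/
def component (K : SimpleGraph U) (v : U) : SimpleGraph U where
  Adj a b := K.Adj a b ∧ K.Reachable v a
  symm := ⟨fun _ _ h => ⟨h.1.symm, h.2.trans h.1.reachable⟩⟩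
  loopless := ⟨fun _ h => h.1.ne rfl⟩

theorem valency_component_of_reachable {K : SimpleGraph U} {v w : U} (h : K.Reachable v w) :
    valency (component K v) w = valency K w := by
  unfold valency
  congr 1
  ext z
  simp [component, h]

section Finite

variable [Finite U]

theorem valency_eq_zero_iff {K : SimpleGraph U} {v : U} :
    valency K v = 0 ↔ ∀ w, ¬ K.Adj v w := by
  unfold valency
  rw [Set.ncard_eq_zero (Set.toFinite _), Set.eq_empty_iff_forall_notMem]
  rfl

theorem even_ncard_odd_valency (K : SimpleGraph U) : Even {v | Odd (valency K v)}.ncard := by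
  classical
  have := Fintype.ofFinite U
  have h := K.even_card_odd_degree_vertices
  simp only [degree_eq_valency] at h
  rw [Set.ncard_eq_toFinset_card']
  convert h
  ext; simp

theorem valency_component_of_not_reachable {K : SimpleGraph U} {v w : U}
    (h : ¬ K.Reachable v w) : valency (component K v) w = 0 := by
  rw [valency_eq_zero_iff]
  simp [component, h]

/-- Handshaking inside one component. This replaces following a path to its other end throughout the
proof. -/
theorem exists_odd_valency_reachable {K : SimpleGraph U} {p : U} (hp : Odd (valency K p)) :
    ∃ q, q ≠ p ∧ K.Reachable p q ∧ Odd (valency K q) := by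
  classical
  have := Fintype.ofFinite U
  obtain ⟨q, hq, ho⟩ := (component K p).exists_ne_odd_degree_of_exists_odd_degree p (by
    rwa [degree_eq_valency, valency_component_of_reachable (Reachable.refl p)])
  rw [degree_eq_valency] at ho
  by_cases h : K.Reachable p q
  · exact ⟨q, hq, h, by rwa [valency_component_of_reachable h] at ho⟩
  · rw [valency_component_of_not_reachable h] at ho
    simp at ho

/-- The perfect matching `M` pairs up the vertices within each component of `K`. Formally, `M`
restricted to the component has exactly the vertices of the component as its vertices of odd
valency. -/
theorem even_compCard_of_valency_eq_one {M K : SimpleGraph U} (hle : M ≤ K)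
    (hM : ∀ v, valency M v = 1) (v : U) : Even (compCard K v) := by
  let M' : SimpleGraph U :=
    { Adj := fun a b => M.Adj a b ∧ K.Reachable v a
      symm := ⟨fun _ _ h => ⟨h.1.symm, h.2.trans (hle h.1).reachable⟩⟩
      loopless := ⟨fun _ h => h.1.ne rfl⟩ }
  have h := even_ncard_odd_valency M'
  suffices he : {w | Odd (valency M' w)} = {w | K.Reachable v w} by
    rwa [he] at h
  ext w
  by_cases hw : K.Reachable v w
  · have : M'.neighborSet w = M.neighborSet w := by
      ext z
      simp [M', hw]
    have h1 := hM w
    unfold valency at h1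
    simp [valency, this, h1, hw]
  · have : M'.neighborSet w = ∅ := by
      ext z
      simp [M', hw]
    simp [valency, this, hw]

theorem mem_edges_of_isCycle {K : SimpleGraph U} {v : U} {C : K.Walk v v} (hC : C.IsCycle)
    (h2 : ∀ w ∈ C.support, valency K w = 2) {w z : U} (hw : w ∈ C.support) (hz : K.Adj w z) :
    s(w, z) ∈ C.edges := by
  have h : C.toSubgraph.neighborSet w = K.neighborSet w := by
    apply Set.eq_of_subset_of_ncard_le (C.toSubgraph.neighborSet_subset w) _ (Set.toFinite _)
    rw [hC.ncard_neighborSet_toSubgraph_eq_two hw]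
    exact (h2 w hw).le
  have : z ∈ C.toSubgraph.neighborSet w := h ▸ hz
  rwa [Subgraph.mem_neighborSet, Walk.adj_toSubgraph_iff_mem_edges] at this

theorem reachable_iff_mem_support_of_isCycle {K : SimpleGraph U} {v : U} {C : K.Walk v v}
    (hC : C.IsCycle) (h2 : ∀ w ∈ C.support, valency K w = 2) (w : U) :
    K.Reachable v w ↔ w ∈ C.support := by
  classical
  refine ⟨fun h => ?_, fun h => ⟨C.takeUntil w h⟩⟩
  exact mem_of_reachable (S := {w | w ∈ C.support}) (fun a ha b hb =>
    C.snd_mem_support_of_mem_edges (mem_edges_of_isCycle hC h2 ha hb)) C.start_mem_support h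

theorem compCard_eq_length {K : SimpleGraph U} {v : U} {C : K.Walk v v} (hC : C.IsCycle)
    (h2 : ∀ w ∈ C.support, valency K w = 2) : compCard K v = C.length := by
  classical
  have h : {w | K.Reachable v w} = (C.support.tail.toFinset : Set U) := by
    ext w
    rw [Set.mem_ofPred_eq, reachable_iff_mem_support_of_isCycle hC h2]
    simp only [List.coe_toFinset, Set.mem_ofPred_eq]
    rw [Walk.mem_support_iff]
    refine ⟨?_, Or.inr⟩
    rintro (rfl | h)
    exacts [Walk.end_mem_tail_support hC.not_nil, h]
  unfold compCard
  rw [h, Set.ncard_coe_finset, List.toFinset_card_of_nodup hC.support_nodup]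
  simp

/-- Deleting an edge `vw` leaves `v` and `w` as the only odd vertices of the component, so
handshaking still connects them, and `vw` lies on a cycle. -/
theorem exists_isCycle_of_valency_eq_two {K : SimpleGraph U} {v : U}
    (h : ∀ w, K.Reachable v w → valency K w = 2) : ∃ C : K.Walk v v, C.IsCycle := by
  classical
  have hv := h v (Reachable.refl v)
  obtain ⟨w, hw⟩ : ∃ w, K.Adj v w := by
    by_contra! hn
    rw [valency_eq_zero_iff.2 hn] at hv
    omega
  set K' := K.deleteEdges {s(v, w)}
  have hle : K' ≤ K := deleteEdges_le _
  have hnv : K'.neighborSet v = K.neighborSet v \ {w} := by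
    ext z
    simp only [K', mem_neighborSet, deleteEdges_adj, Set.mem_singleton_iff, Set.mem_sdiff]
    grind [Sym2.eq_iff]
  have ho : Odd (valency K' v) := by
    unfold valency at hv ⊢
    rw [hnv, Set.ncard_sdiff_singleton_of_mem (show w ∈ K.neighborSet v from hw), hv]
    exact odd_one
  obtain ⟨q, hq, hr, hoq⟩ := exists_odd_valency_reachable ho
  have hqw : q = w := by
    by_contra hqw
    have : K'.neighborSet q = K.neighborSet q := by
      ext z
      simp only [K', mem_neighborSet, deleteEdges_adj, Set.mem_singleton_iff]
      grind [Sym2.eq_iff]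
    unfold valency at hoq h
    rw [this, h q (hr.mono hle)] at hoq
    exact absurd hoq (by decide)
  subst hqw
  obtain ⟨u, C, hC, he⟩ := adj_and_reachable_delete_edges_iff_exists_cycle.1 ⟨hw, hr⟩
  exact ⟨C.rotate v (C.fst_mem_support_of_mem_edges he), hC.rotate _⟩

theorem IsOdd.odd_compCard {K : SimpleGraph U} (hK : IsOdd K) {v : U}
    (h : ∀ w, K.Reachable v w → valency K w = 2) : Odd (compCard K v) := by
  classical
  obtain ⟨C, hC⟩ := exists_isCycle_of_valency_eq_two h
  rw [compCard_eq_length hC fun w hw => h w ⟨C.takeUntil w hw⟩]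
  exact hK v C hC

/-- Valency zero is harmless: an isolated vertex is a component of size one. This is what allows
deleted vertices to be kept as isolated ones. -/
theorem IsOdd.allOdd {K : SimpleGraph U} (hK : IsOdd K)
    (h : ∀ v, valency K v = 2 ∨ valency K v = 0) : AllOdd K := by
  intro v
  rcases h v with hv | hv
  · refine hK.odd_compCard fun w hw => ?_
    refine mem_of_reachable (S := {w | valency K w = 2}) (fun a _ b hab => ?_) hv hw
    exact (h b).resolve_right fun h0 => valency_eq_zero_iff.1 h0 a hab.symm
  · rw [compCard_eq_one (valency_eq_zero_iff.1 hv)]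
    exact odd_one

theorem AllOdd.isOdd {K : SimpleGraph U} (hK : AllOdd K) (h : ∀ v, valency K v = 2) :
    IsOdd K := by
  intro v C hC
  rw [← compCard_eq_length hC fun w _ => h w]
  exact hK v

theorem mem_edges_of_isPath {K : SimpleGraph U} {p q : U} {P : K.Walk p q} (hP : P.IsPath)
    (hpq : p ≠ q) (hp : valency K p = 1) (hq : valency K q = 1)
    (h2 : ∀ w, w ≠ p → w ≠ q → valency K w = 2) {w z : U} (hw : w ∈ P.support)
    (hz : K.Adj w z) : s(w, z) ∈ P.edges := by
  have hn : ¬ P.Nil := fun h => hpq h.eq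
  have h : P.toSubgraph.neighborSet w = K.neighborSet w := by
    apply Set.eq_of_subset_of_ncard_le (P.toSubgraph.neighborSet_subset w) _ (Set.toFinite _)
    change valency K w ≤ _
    by_cases hwp : w = p
    · subst hwp
      rw [hP.neighborSet_toSubgraph_startpoint hn, Set.ncard_singleton, hp]
    by_cases hwq : w = q
    · subst hwq
      rw [hP.neighborSet_toSubgraph_endpoint hn, Set.ncard_singleton, hq]
    obtain ⟨i, rfl, hi⟩ := Walk.mem_support_iff_exists_getVert.1 hw
    rw [hP.ncard_neighborSet_toSubgraph_internal_eq_two, h2 _ hwp hwq]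
    · rintro rfl
      simp at hwp
    · refine lt_of_le_of_ne hi ?_
      rintro rfl
      simp at hwq
  have : z ∈ P.toSubgraph.neighborSet w := h ▸ hz
  rwa [Subgraph.mem_neighborSet, Walk.adj_toSubgraph_iff_mem_edges] at this

/-- The vertices of the path are counted by the length of the cycle that a new edge `pq` would
close, which is the quantity in `even_new`. -/
theorem compCard_eq_length_add_one {K : SimpleGraph U} {p q : U} {P : K.Walk p q}
    (hP : P.IsPath) (hpq : p ≠ q) (hp : valency K p = 1) (hq : valency K q = 1)
    (h2 : ∀ w, w ≠ p → w ≠ q → valency K w = 2) : compCard K p = P.length + 1 := by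
  classical
  have h : {w | K.Reachable p w} = (P.support.toFinset : Set U) := by
    ext w
    simp only [List.coe_toFinset, Set.mem_ofPred_eq]
    refine ⟨fun h => ?_, fun h => ⟨P.takeUntil w h⟩⟩
    exact mem_of_reachable (S := {w | w ∈ P.support}) (fun a ha b hb =>
      P.snd_mem_support_of_mem_edges (mem_edges_of_isPath hP hpq hp hq h2 ha hb))
      P.start_mem_support h
  unfold compCard
  rw [h, Set.ncard_coe_finset, List.toFinset_card_of_nodup hP.support_nodup]
  simp

end Finite

end BoldGadget

/-! ### Component sizes when edges are added or two graphs are glued -/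

namespace BoldGadget

open SimpleGraph

variable {U U' V W : Type*}

theorem reachable_sup_edge_iff {B : SimpleGraph U} {p q v w : U} :
    (B ⊔ edge p q).Reachable v w ↔ B.Reachable v w ∨ (B.Reachable v p ∧ B.Reachable q w) ∨
      (B.Reachable v q ∧ B.Reachable p w) := by
  constructor
  · intro h
    refine mem_of_reachable (S := {w | B.Reachable v w ∨ (B.Reachable v p ∧ B.Reachable q w) ∨
      (B.Reachable v q ∧ B.Reachable p w)}) ?_ (Or.inl (Reachable.refl v)) h
    intro z hz z' hzz'
    rw [sup_adj, edge_adj] at hzz'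
    simp only [Set.mem_ofPred_eq] at hz ⊢
    rcases hzz' with h | ⟨⟨rfl, rfl⟩ | ⟨rfl, rfl⟩, -⟩
    · have := h.reachable
      rcases hz with h1 | ⟨h1, h2⟩ | ⟨h1, h2⟩
      · exact Or.inl (h1.trans this)
      · exact Or.inr (Or.inl ⟨h1, h2.trans this⟩)
      · exact Or.inr (Or.inr ⟨h1, h2.trans this⟩)
    · rcases hz with h1 | ⟨h1, h2⟩ | ⟨h1, h2⟩
      · exact Or.inr (Or.inl ⟨h1, Reachable.refl _⟩)
      · exact Or.inr (Or.inl ⟨h1, Reachable.refl _⟩)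
      · exact Or.inl h1
    · rcases hz with h1 | ⟨h1, h2⟩ | ⟨h1, h2⟩
      · exact Or.inr (Or.inr ⟨h1, Reachable.refl _⟩)
      · exact Or.inl h1
      · exact Or.inr (Or.inr ⟨h1, Reachable.refl _⟩)
  · have hle : B ≤ B ⊔ edge p q := le_sup_left
    have hpq : (B ⊔ edge p q).Reachable p q := by
      by_cases h : p = q
      · rw [h]
      · exact Adj.reachable (by simp [edge_adj, h])
    rintro (h | ⟨h, h'⟩ | ⟨h, h'⟩)
    · exact h.mono hle
    · exact (h.mono hle).trans (hpq.trans (h'.mono hle))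
    · exact (h.mono hle).trans (hpq.symm.trans (h'.mono hle))

theorem reachable_sup_edge_iff_of_reachable {B : SimpleGraph U} {p q : U} (h : B.Reachable p q)
    (v w : U) : (B ⊔ edge p q).Reachable v w ↔ B.Reachable v w := by
  rw [reachable_sup_edge_iff]
  refine ⟨?_, Or.inl⟩
  rintro (h1 | ⟨h1, h2⟩ | ⟨h1, h2⟩)
  exacts [h1, h1.trans (h.trans h2), h1.trans (h.symm.trans h2)]

theorem compCard_sup_edge_of_reachable {B : SimpleGraph U} {p q : U} (h : B.Reachable p q)
    (v : U) : compCard (B ⊔ edge p q) v = compCard B v := by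
  unfold compCard
  simp only [reachable_sup_edge_iff_of_reachable h]

theorem allOdd_sup_edge_iff {B : SimpleGraph U} {p q : U} (h : B.Reachable p q) :
    AllOdd (B ⊔ edge p q) ↔ AllOdd B := by
  unfold AllOdd
  simp only [compCard_sup_edge_of_reachable h]

theorem compCard_sup_edge_of_not {B : SimpleGraph U} {p q v : U} (hp : ¬ B.Reachable p v)
    (hq : ¬ B.Reachable q v) : compCard (B ⊔ edge p q) v = compCard B v := by
  unfold compCard
  congr 1
  ext w
  rw [Set.mem_ofPred_eq, Set.mem_ofPred_eq, reachable_sup_edge_iff]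
  exact ⟨fun h => h.resolve_right (by
    rintro (h | h)
    exacts [hp h.1.symm, hq h.1.symm]), Or.inl⟩

theorem compCard_sup_edge_left [Finite U] {B : SimpleGraph U} {p q : U}
    (h : ¬ B.Reachable p q) : compCard (B ⊔ edge p q) p = compCard B p + compCard B q := by
  unfold compCard
  rw [← Set.ncard_union_eq _ (Set.toFinite _) (Set.toFinite _)]
  · congr 1
    ext w
    simp only [Set.mem_union, Set.mem_ofPred_eq, reachable_sup_edge_iff]
    refine ⟨?_, ?_⟩
    · rintro (h1 | ⟨h1, h2⟩ | ⟨h1, h2⟩)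
      exacts [Or.inl h1, Or.inr h2, Or.inl h2]
    · rintro (h1 | h1)
      exacts [Or.inl h1, Or.inr (Or.inl ⟨Reachable.refl _, h1⟩)]
  · rw [Set.disjoint_left]
    exact fun w h1 h2 => h (h1.trans h2.symm)

theorem adj_reachable_sup_edge {B : SimpleGraph U} (p q : U) : (B ⊔ edge p q).Reachable p q :=
  reachable_sup_edge_iff.2 (Or.inr (Or.inl ⟨Reachable.refl _, Reachable.refl _⟩))

/-- The first edge merges the two components, and the second then joins vertices already connected,
so only the sum of the two sizes matters. -/
theorem AllOdd.of_glue [Finite U] {B : SimpleGraph U} {r s a b : U} (hrs : B.Reachable r s)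
    (hab : B.Reachable a b) (hra : ¬ B.Reachable r a)
    (h : ∀ v, ¬ B.Reachable r v → ¬ B.Reachable a v → Odd (compCard B v))
    (hs : Odd (compCard B r + compCard B a)) : AllOdd (B ⊔ edge r a ⊔ edge s b) := by
  have hle : B ≤ B ⊔ edge r a := le_sup_left
  have hra' := adj_reachable_sup_edge (B := B) r a
  rw [allOdd_sup_edge_iff ((hrs.symm.mono hle).trans (hra'.trans (hab.mono hle)))]
  intro v
  by_cases h1 : B.Reachable r v
  · rw [← compCard_congr (h1.mono hle), compCard_sup_edge_left hra]
    exact hs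
  by_cases h2 : B.Reachable a v
  · rw [← compCard_congr (hra'.trans (h2.mono hle)), compCard_sup_edge_left hra]
    exact hs
  · rw [compCard_sup_edge_of_not h1 h2]
    exact h v h1 h2

theorem not_reachable_of_isolated {B : SimpleGraph U} {x v : U} (hx : ∀ w, ¬ B.Adj x w)
    (h : x ≠ v) : ¬ B.Reachable x v := fun hr =>
  h (mem_of_reachable (S := {x}) (by rintro _ rfl w hw; exact (hx w hw).elim) rfl hr).symm

/-- Adding both edges at the isolated vertex `x` enlarges the component of `r` by exactly one
vertex, which flips its parity. -/
theorem AllOdd.remove_vertex [Finite U] {B : SimpleGraph U} {x r s : U}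
    (hx : ∀ w, ¬ B.Adj x w) (hxr : x ≠ r) (hrs : B.Reachable r s)
    (h : AllOdd (B ⊔ edge x r ⊔ edge x s)) :
    Even (compCard B r) ∧ ∀ v, ¬ B.Reachable r v → Odd (compCard B v) := by
  have hle : B ≤ B ⊔ edge x r := le_sup_left
  have hxr' := adj_reachable_sup_edge (B := B) x r
  have hnr := not_reachable_of_isolated hx hxr
  rw [allOdd_sup_edge_iff (hxr'.trans (hrs.mono hle))] at h
  refine ⟨?_, fun v hv => ?_⟩
  · have := h x
    rw [compCard_sup_edge_left hnr, compCard_eq_one hx] at this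
    grind
  · by_cases hvx : x = v
    · rw [← hvx, compCard_eq_one hx]
      exact odd_one
    · rw [← compCard_sup_edge_of_not (not_reachable_of_isolated hx hvx) hv]
      exact h v

/-- Two vertices are taken out of the component, so its parity stays. The proof removes `y` by
`AllOdd.remove_vertex` and then discounts `x`. -/
theorem AllOdd.remove_edge [Finite U] {B : SimpleGraph U} {x y r t : U}
    (hx : ∀ w, ¬ B.Adj x w) (hy : ∀ w, ¬ B.Adj y w) (hxy : x ≠ y) (hxr : x ≠ r) (hyr : y ≠ r)
    (hrt : B.Reachable r t)
    (h : AllOdd (B ⊔ edge x r ⊔ edge x y ⊔ edge y t)) :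
    Odd (compCard B r) ∧ ∀ v, ¬ B.Reachable r v → Odd (compCard B v) := by
  have hle : B ≤ B ⊔ edge x r := le_sup_left
  have hxr' := adj_reachable_sup_edge (B := B) x r
  rw [edge_comm (s := x) (t := y)] at h
  have hy' : ∀ w, ¬ (B ⊔ edge x r).Adj y w := by
    intro w
    simp [edge_adj, hy, hxy.symm, hyr]
  obtain ⟨h1, h2⟩ := h.remove_vertex hy' hxy.symm (hxr'.trans (hrt.mono hle))
  refine ⟨?_, fun v hv => ?_⟩
  · rw [compCard_sup_edge_left (not_reachable_of_isolated hx hxr), compCard_eq_one hx] at h1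
    grind
  · by_cases hvx : x = v
    · rw [← hvx, compCard_eq_one hx]
      exact odd_one
    · have hxv := not_reachable_of_isolated hx hvx
      rw [← compCard_sup_edge_of_not hxv hv]
      refine h2 v fun hr => ?_
      rw [reachable_sup_edge_iff] at hr
      rcases hr with h | h | h
      exacts [hxv h, hv h.2, hxv h.2]

theorem compCard_map (K : SimpleGraph U) (f : U ↪ U') (v : U) :
    compCard (K.map f) (f v) = compCard K v := by
  unfold compCard
  rw [← Set.ncard_image_of_injective _ f.injective]
  congr 1
  ext w
  refine ⟨fun h => ?_, ?_⟩
  · refine mem_of_reachable (S := f '' {z | K.Reachable v z}) ?_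
      (Set.mem_image_of_mem f (show v ∈ {z | K.Reachable v z} from Reachable.refl v)) h
    rintro _ ⟨z, hz, rfl⟩ z' hz'
    obtain ⟨-, p, q, hpq, hp, rfl⟩ := hz'
    exact ⟨q, Reachable.trans hz (f.injective hp ▸ hpq.reachable), rfl⟩
  · rintro ⟨w, h, rfl⟩
    exact Reachable.map (Embedding.map f K).toHom h

theorem valency_map (K : SimpleGraph U) (f : U ↪ U') (v : U) :
    valency (K.map f) (f v) = valency K v := by
  unfold valency
  rw [← Set.ncard_image_of_injective _ f.injective]
  congr 1
  ext w
  constructor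
  · rintro ⟨-, p, q, hpq, hp, rfl⟩
    exact ⟨q, f.injective hp ▸ hpq, rfl⟩
  · rintro ⟨w, h, rfl⟩
    exact (Embedding.map f K).map_rel_iff.2 h

theorem reachable_sum_inl_iff {Q : SimpleGraph V} {P : SimpleGraph W} {v w : V} :
    (Q ⊕g P).Reachable (Sum.inl v) (Sum.inl w) ↔ Q.Reachable v w := by
  constructor
  · intro h
    have := mem_of_reachable (S := Sum.inl '' {z | Q.Reachable v z}) ?_
      (Set.mem_image_of_mem _ (show v ∈ {z | Q.Reachable v z} from Reachable.refl v)) h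
    · obtain ⟨z, hz, hzw⟩ := this
      rwa [← Sum.inl_injective hzw]
    · rintro _ ⟨z, hz, rfl⟩ (z' | z') hz'
      · exact ⟨z', Reachable.trans hz (Adj.reachable hz'), rfl⟩
      · simp at hz'
  · intro h
    exact h.map Embedding.sumInl.toHom

theorem reachable_sum_inr_iff {Q : SimpleGraph V} {P : SimpleGraph W} {v w : W} :
    (Q ⊕g P).Reachable (Sum.inr v) (Sum.inr w) ↔ P.Reachable v w := by
  constructor
  · intro h
    have := mem_of_reachable (S := Sum.inr '' {z | P.Reachable v z}) ?_
      (Set.mem_image_of_mem _ (show v ∈ {z | P.Reachable v z} from Reachable.refl v)) h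
    · obtain ⟨z, hz, hzw⟩ := this
      rwa [← Sum.inr_injective hzw]
    · rintro _ ⟨z, hz, rfl⟩ (z' | z') hz'
      · simp at hz'
      · exact ⟨z', Reachable.trans hz (Adj.reachable hz'), rfl⟩
  · intro h
    exact h.map Embedding.sumInr.toHom

theorem compCard_sum_inl (Q : SimpleGraph V) (P : SimpleGraph W) (v : V) :
    compCard (Q ⊕g P) (Sum.inl v) = compCard Q v := by
  unfold compCard
  rw [← Set.ncard_image_of_injective {w | Q.Reachable v w} (Sum.inl_injective (β := W))]
  congr 1
  ext (w | w)
  · simp [reachable_sum_inl_iff]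
  · simpa using not_reachable_sum_inl_inr (G := Q) (H := P) v w

theorem compCard_sum_inr (Q : SimpleGraph V) (P : SimpleGraph W) (v : W) :
    compCard (Q ⊕g P) (Sum.inr v) = compCard P v := by
  unfold compCard
  rw [← Set.ncard_image_of_injective {w | P.Reachable v w} (Sum.inr_injective (α := V))]
  congr 1
  ext (w | w)
  · simpa using fun h => not_reachable_sum_inl_inr (G := Q) (H := P) w v (Reachable.symm h)
  · simp [reachable_sum_inr_iff]

theorem valency_sum_inl (Q : SimpleGraph V) (P : SimpleGraph W) (v : V) :
    valency (Q ⊕g P) (Sum.inl v) = valency Q v := by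
  unfold valency
  rw [neighborSet_sum_inl, Set.ncard_image_of_injective _ Sum.inl_injective]

theorem valency_sum_inr (Q : SimpleGraph V) (P : SimpleGraph W) (v : W) :
    valency (Q ⊕g P) (Sum.inr v) = valency P v := by
  unfold valency
  rw [neighborSet_sum_inr, Set.ncard_image_of_injective _ Sum.inr_injective]

open Classical in
theorem valency_sup_edge [Finite U] {B : SimpleGraph U} {p q : U} (hpq : p ≠ q)
    (h : ¬ B.Adj p q) (v : U) :
    valency (B ⊔ edge p q) v = valency B v + if v = p ∨ v = q then 1 else 0 := by
  unfold valency
  have key : ∀ z, z ∉ B.neighborSet v → (B ⊔ edge p q).neighborSet v = insert z (B.neighborSet v) →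
      ((B ⊔ edge p q).neighborSet v).ncard = (B.neighborSet v).ncard + 1 := by
    intro z hz he
    rw [he, Set.ncard_insert_of_notMem hz (Set.toFinite _)]
  split_ifs with hv
  · rcases hv with rfl | rfl
    · refine key q h ?_
      ext w
      simp only [mem_neighborSet, sup_adj, edge_adj, Set.mem_insert_iff]
      grind
    · refine key p (fun hh => h hh.symm) ?_
      ext w
      simp only [mem_neighborSet, sup_adj, edge_adj, Set.mem_insert_iff]
      grind
  · congr 1
    ext w
    simp only [mem_neighborSet, sup_adj, edge_adj]
    grind

theorem allOdd_of_isOdd_induce [Finite U] {K : SimpleGraph U} {y : U} (hy : valency K y = 0)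
    (h2 : ∀ v, v ≠ y → valency K v = 2) (h : IsOdd (K.induce {y}ᶜ)) : AllOdd K := by
  have hK : (K.induce {y}ᶜ).map (Function.Embedding.subtype _) = K := by
    rw [valency_eq_zero_iff] at hy
    ext v w
    simp only [map_adj, comap_adj, Function.Embedding.subtype_apply, Subtype.exists]
    constructor
    · rintro ⟨v, -, w, -, hvw, rfl, rfl⟩
      exact hvw
    · intro hvw
      refine ⟨v, ?_, w, ?_, hvw, rfl, rfl⟩
      · rintro rfl
        exact hy _ hvw
      · rintro rfl
        exact hy _ hvw.symm
  intro v
  by_cases hv : v = y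
  · rw [hv, compCard_eq_one (valency_eq_zero_iff.1 hy)]
    exact odd_one
  · have hodd : AllOdd (K.induce {y}ᶜ) := h.allOdd fun w => Or.inl (by
      rw [← valency_map _ (Function.Embedding.subtype _), hK]
      exact h2 _ w.2)
    have := hodd ⟨v, hv⟩
    rwa [← compCard_map _ (Function.Embedding.subtype _), hK] at this

end BoldGadget

/-! ### Gluing the traces of a 2-factor on `L` and on `R` -/

namespace BoldGadget

open SimpleGraph

variable {V W : Type*}

theorem sup_edge_le {K G : SimpleGraph V} {p q : V} (h : K ≤ G) (hpq : G.Adj p q) :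
    K ⊔ edge p q ≤ G :=
  sup_le h ((edge_le_iff _).2 (Or.inr hpq))

theorem reachable_of_odd_valency [Finite V] {K : SimpleGraph V} {p q : V}
    (hp : Odd (valency K p)) (h : ∀ v, Odd (valency K v) → v = p ∨ v = q) : K.Reachable p q := by
  obtain ⟨z, hz, hr, ho⟩ := exists_odd_valency_reachable hp
  exact (h z ho).resolve_left hz ▸ hr

open Classical in
/-- All vertices of `K` have valency two, except those of `A` (valency zero) and of `B`
(valency one). -/
def HasDefects (K : SimpleGraph V) (A B : Set V) : Prop :=
  ∀ v, valency K v = if v ∈ A then 0 else if v ∈ B then 1 else 2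

namespace HasDefects

variable {K : SimpleGraph V} {A B : Set V}

theorem not_adj [Finite V] (h : HasDefects K A B) {v : V} (hv : v ∈ A) (w : V) : ¬ K.Adj v w := by
  have := h v
  rw [if_pos hv, valency_eq_zero_iff] at this
  exact this w

theorem odd_iff (h : HasDefects K A B) (v : V) : Odd (valency K v) ↔ v ∉ A ∧ v ∈ B := by
  rw [h v]
  split_ifs with h1 h2
  · simp [h1]
  · simp [h1, h2]
  · simp [h2]

/-- With only two candidates for odd valency, handshaking in the component of `p` must find `q`
there. -/
theorem reachable [Finite V] {p q : V} (h : HasDefects K A B) (hp : p ∉ A) (hB : B = {p, q}) :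
    K.Reachable p q := by
  refine reachable_of_odd_valency ((h.odd_iff p).2 ⟨hp, by simp [hB]⟩) fun v hv => ?_
  have := ((h.odd_iff v).1 hv).2
  rw [hB] at this
  simpa using this

end HasDefects

theorem allOdd_glue_sum [Finite V] [Finite W] {Q : SimpleGraph V} {P : SimpleGraph W}
    {r s : V} {a b : W} (hrs : Q.Reachable r s) (hab : P.Reachable a b)
    (hQ : ∀ v, ¬ Q.Reachable r v → Odd (compCard Q v))
    (hP : ∀ v, ¬ P.Reachable a v → Odd (compCard P v))
    (h : Odd (compCard Q r + compCard P a)) :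
    AllOdd ((Q ⊕g P) ⊔ edge (Sum.inl r) (Sum.inr a) ⊔ edge (Sum.inl s) (Sum.inr b)) := by
  refine AllOdd.of_glue (reachable_sum_inl_iff.2 hrs) (reachable_sum_inr_iff.2 hab)
    (not_reachable_sum_inl_inr _ _) ?_ (by rwa [compCard_sum_inl, compCard_sum_inr])
  rintro (v | v) h1 h2
  · rw [compCard_sum_inl]
    exact hQ v fun h => h1 (reachable_sum_inl_iff.2 h)
  · rw [compCard_sum_inr]
    exact hP v fun h => h2 (reachable_sum_inr_iff.2 h)

theorem sum_sup_edge_inl (Q : SimpleGraph V) (P : SimpleGraph W) (p q : V) :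
    ((Q ⊔ edge p q) ⊕g P) = (Q ⊕g P) ⊔ edge (Sum.inl p) (Sum.inl q) := by
  ext (v | v) (w | w) <;> simp [edge_adj]

section Cases

variable [Finite V] [Finite W] {L Q : SimpleGraph V} {R P : SimpleGraph W} {x y r s t u : V}
  {a b c d : W}

-- Even plus odd: `x` closes the `r`-`s` path into a 2-factor of `L - y`, and `ab` closes the
-- `a`-`b` path into a 2-factor of `R` without `cd`.
open Classical in
theorem allOdd_of_same_side (hb : IsBoldEdge L x y) (hxr : L.Adj x r) (hxs : L.Adj x s)
    (hrs : r ≠ s) (hyr : y ≠ r) (hys : y ≠ s) (hQL : Q ≤ L) (hQ : HasDefects Q {x, y} {r, s})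
    (hg : IsGadgetPair R a b c d) (hPR : P ≤ R.deleteEdges {s(a, b), s(c, d)})
    (hP : HasDefects P ∅ {a, b}) :
    AllOdd ((Q ⊕g P) ⊔ edge (Sum.inl r) (Sum.inr a) ⊔ edge (Sum.inl s) (Sum.inr b)) := by
  have hxQ := hQ.not_adj (v := x) (by simp)
  have hxy := hb.adj.ne
  have hrs' := hQ.reachable (by simp [hxr.ne', hyr.symm]) rfl
  have hab' := hP.reachable (by simp) rfl
  obtain ⟨hi1, hi2, hi3, hi4⟩ := hg.independent
  have hab := hg.adj_left.ne
  have hcd := hg.adj_right.ne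
  have hPab : ¬ P.Adj a b := fun h => by simpa using hPR h
  have hPcd : ¬ P.Adj c d := fun h => by simpa using hPR h
  have hL : AllOdd (Q ⊔ edge x r ⊔ edge x s) := by
    have hval : ∀ v, valency (Q ⊔ edge x r ⊔ edge x s) v = if v = y then 0 else 2 := by
      intro v
      have := hxr.ne
      have := hxs.ne
      rw [valency_sup_edge hxs.ne (by simp [edge_adj, hxQ, hrs.symm, hxr.ne]),
        valency_sup_edge hxr.ne (hxQ r), hQ v]
      simp only [Set.mem_insert_iff, Set.mem_singleton_iff]
      grind
    refine allOdd_of_isOdd_induce (y := y) (by simp [hval]) (fun v hv => by simp [hval, hv])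
      (hb.odd_delete_right _ ⟨?_, fun v => ?_⟩)
    · intro v w h
      exact sup_edge_le (sup_edge_le hQL hxr) hxs h
    · have h2 := hval v
      rw [if_neg (show (v : V) ≠ y from v.2)] at h2
      rw [← h2]
      unfold valency
      rw [← Set.ncard_image_of_injective _ (Subtype.val_injective)]
      congr 1
      ext w
      constructor
      · rintro ⟨w, h, rfl⟩
        exact h
      · intro h
        refine ⟨⟨w, ?_⟩, h, rfl⟩
        rintro rfl
        have := hval w
        rw [if_pos rfl, valency_eq_zero_iff] at this
        exact this v (Adj.symm h)
  obtain ⟨hr, hQo⟩ := hL.remove_vertex hxQ hxr.ne hrs'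
  have hR : AllOdd P := by
    -- Closing the path by `ab` does not change the components.
    rw [← allOdd_sup_edge_iff hab']
    have hval : ∀ v, valency (P ⊔ edge a b) v = 2 := by
      intro v
      rw [valency_sup_edge hab hPab, hP v]
      simp only [Set.mem_insert_iff, Set.mem_singleton_iff, Set.mem_empty_iff_false]
      grind
    refine (hg.odd_one _ ⟨?_, hval⟩ (Or.inl ⟨?_, ?_⟩)).allOdd fun v => Or.inl (hval v)
    · exact sup_edge_le (hPR.trans (deleteEdges_le _)) hg.adj_left
    · simp [edge_adj, hab]
    · simp [edge_adj, hPcd]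
      grind
  exact allOdd_glue_sum hrs' hab' hQo (fun v _ => hR v) (hr.add_odd (hR a))

-- Odd plus even: `r x y t` closes the path in `L` into a 2-factor containing `xy`, and the new edge
-- `ac` closes the path in `R` into an even cycle.
open Classical in
theorem allOdd_of_both_sides (hb : IsBoldEdge L x y) (hxr : L.Adj x r) (hyt : L.Adj y t)
    (hrt : r ≠ t) (hyr : y ≠ r) (hxt : x ≠ t) (hQL : Q ≤ L) (hQ : HasDefects Q {x, y} {r, t})
    (hg : IsGadgetPair R a b c d) (hPR : P ≤ R.deleteEdges {s(a, b), s(c, d)})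
    (hP : HasDefects P ∅ {a, c}) :
    AllOdd ((Q ⊕g P) ⊔ edge (Sum.inl r) (Sum.inr a) ⊔ edge (Sum.inl t) (Sum.inr c)) := by
  have hxQ := hQ.not_adj (v := x) (by simp)
  have hyQ := hQ.not_adj (v := y) (by simp)
  have hxy := hb.adj.ne
  have hrt' := hQ.reachable (by simp [hxr.ne', hyr.symm]) rfl
  have hac' := hP.reachable (by simp) rfl
  have hac := hg.independent.1
  have hL : AllOdd (Q ⊔ edge x r ⊔ edge x y ⊔ edge y t) := by
    have hval : ∀ v, valency (Q ⊔ edge x r ⊔ edge x y ⊔ edge y t) v = 2 := by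
      intro v
      have := hxr.ne
      have := hyt.ne
      rw [valency_sup_edge hyt.ne (by simp [edge_adj, hyQ, hxt.symm, hyt.ne', hxy.symm]),
        valency_sup_edge hxy (by simp [edge_adj, hxQ, hyr, hxr.ne]),
        valency_sup_edge hxr.ne (hxQ r), hQ v]
      simp only [Set.mem_insert_iff, Set.mem_singleton_iff]
      grind
    refine (hb.odd_containing _ ⟨?_, hval⟩ ?_).allOdd fun v => Or.inl (hval v)
    · exact sup_edge_le (sup_edge_le (sup_edge_le hQL hxr) hb.adj) hyt
    · simp [edge_adj, hxy]
  obtain ⟨hr, hQo⟩ := hL.remove_edge hxQ hyQ hxy hxr.ne hyr hrt'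
  have hH : IsTwoFactorWithNewEdge (R.deleteEdges {s(a, b), s(c, d)}) P a c := by
    refine ⟨hPR, ?_, ?_, fun v hva hvc => ?_⟩
    · exact (hP a).trans (by simp)
    · exact (hP c).trans (by simp)
    · exact (hP v).trans (by simp [hva, hvc])
  refine allOdd_glue_sum hrt' hac' hQo (fun v hv => ?_) (hr.add_even ?_)
  · refine (hg.odd_old a c (Or.inl rfl) (Or.inl rfl) P hH).odd_compCard fun w hw => ?_
    refine hH.2.2.2 w ?_ ?_
    · rintro rfl
      exact hv hw.symm
    · rintro rfl
      exact hv (hac'.trans hw.symm)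
  · obtain ⟨p, hp⟩ := hac'.exists_isPath
    rw [compCard_eq_length_add_one hp hac hH.2.1 hH.2.2.1 hH.2.2.2]
    exact hg.even_new a c (Or.inl rfl) (Or.inl rfl) P hH p hp

-- Restoring `ab` and `cd` gives a 2-factor of `R` containing both, in which they lie on different
-- cycles. Hence the path of `P` from `a` can end neither at `c` nor at `d`, and ends at `b`.
open Classical in
theorem IsGadgetPair.reachable_of_four (hg : IsGadgetPair R a b c d)
    (hPR : P ≤ R.deleteEdges {s(a, b), s(c, d)}) (hP : HasDefects P ∅ {a, b, c, d}) :
    AllOdd P ∧ P.Reachable a b ∧ P.Reachable c d ∧ ¬ P.Reachable a c := by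
  obtain ⟨hi1, hi2, hi3, hi4⟩ := hg.independent
  have hab := hg.adj_left.ne
  have hcd := hg.adj_right.ne
  have hPab : ¬ P.Adj a b := fun h => by simpa using hPR h
  have hPcd : ¬ P.Adj c d := fun h => by simpa using hPR h
  set F := P ⊔ edge a b ⊔ edge c d with hF
  have hle : P ≤ F := le_sup_left.trans le_sup_left
  have hFab : F.Adj a b := by simp [hF, edge_adj, hab]
  have hFcd : F.Adj c d := by simp [hF, edge_adj, hcd]
  have hval : ∀ v, valency F v = 2 := by
    intro v
    rw [valency_sup_edge hcd (by simp [edge_adj, hPcd]; grind), valency_sup_edge hab hPab, hP v]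
    simp only [Set.mem_insert_iff, Set.mem_singleton_iff, Set.mem_empty_iff_false]
    grind
  have hFR : IsTwoFactor R F :=
    ⟨sup_edge_le (sup_edge_le (hPR.trans (deleteEdges_le _)) hg.adj_left) hg.adj_right, hval⟩
  have hFac : ¬ F.Reachable a c := by
    intro h
    obtain ⟨C, hC⟩ := exists_isCycle_of_valency_eq_two (K := F) (v := a) fun w _ => hval w
    refine hg.different_cycles F hFR hFab hFcd a C hC ⟨?_, ?_⟩
    · exact mem_edges_of_isCycle hC (fun w _ => hval w) C.start_mem_support hFab
    · exact mem_edges_of_isCycle hC (fun w _ => hval w)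
        ((reachable_iff_mem_support_of_isCycle hC (fun w _ => hval w) c).1 h) hFcd
  have hab' : P.Reachable a b := by
    obtain ⟨q, hqa, hq, ho⟩ := exists_odd_valency_reachable ((hP.odd_iff a).2 (by simp))
    have hq' := hq.mono hle
    rw [hP.odd_iff] at ho
    rcases ho.2 with rfl | rfl | rfl | rfl
    exacts [absurd rfl hqa, hq, absurd hq' hFac, absurd (hq'.trans hFcd.symm.reachable) hFac]
  have hcd' : P.Reachable c d := by
    obtain ⟨q, hqc, hq, ho⟩ := exists_odd_valency_reachable ((hP.odd_iff c).2 (by simp))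
    have hq' := (hq.mono hle).symm
    rw [hP.odd_iff] at ho
    rcases ho.2 with rfl | rfl | rfl | rfl
    exacts [absurd hq' hFac, absurd (hFab.reachable.trans hq') hFac, absurd rfl hqc, hq]
  refine ⟨?_, hab', hcd', fun h => hFac (h.mono hle)⟩
  have := (hg.odd_both F hFR hFab hFcd).allOdd fun v => Or.inl (hval v)
  rwa [hF, allOdd_sup_edge_iff (hcd'.mono le_sup_left), allOdd_sup_edge_iff hab'] at this

-- The vertices `x` and `y` of a 2-factor of `L` avoiding `xy` are exchanged for the odd paths of
-- `P`, one after the other: `Q₁` still contains `y` while `x` is being replaced.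
open Classical in
theorem allOdd_of_four (hb : IsBoldEdge L x y) (hxr : L.Adj x r) (hxs : L.Adj x s)
    (hyt : L.Adj y t) (hyu : L.Adj y u) (hrs : r ≠ s) (htu : t ≠ u) (hrt : r ≠ t) (hru : r ≠ u)
    (hst : s ≠ t) (hsu : s ≠ u) (hyr : y ≠ r) (hys : y ≠ s) (hxt : x ≠ t) (hxu : x ≠ u)
    (hQL : Q ≤ L) (hQ : HasDefects Q {x, y} {r, s, t, u})
    (hg : IsGadgetPair R a b c d) (hPR : P ≤ R.deleteEdges {s(a, b), s(c, d)})
    (hP : HasDefects P ∅ {a, b, c, d}) :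
    AllOdd ((Q ⊕g P) ⊔ edge (Sum.inl r) (Sum.inr a) ⊔ edge (Sum.inl s) (Sum.inr b) ⊔
      edge (Sum.inl t) (Sum.inr c) ⊔ edge (Sum.inl u) (Sum.inr d)) := by
  obtain ⟨hPo, hab', hcd', hac'⟩ := hg.reachable_of_four hPR hP
  obtain ⟨hi1, hi2, hi3, hi4⟩ := hg.independent
  have hab := hg.adj_left.ne
  have hcd := hg.adj_right.ne
  have hPcd : ¬ P.Adj c d := fun h => by simpa using hPR h
  have hxQ := hQ.not_adj (v := x) (by simp)
  have hyQ := hQ.not_adj (v := y) (by simp)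
  have hxy := hb.adj.ne
  have hxr' := hxr.ne
  have hxs' := hxs.ne
  have hyt' := hyt.ne
  have hyu' := hyu.ne
  set Q₁ := Q ⊔ edge y t ⊔ edge y u with hQ₁
  have hQ₁d : HasDefects Q₁ {x} {r, s} := by
    intro v
    rw [valency_sup_edge hyu' (by simp [edge_adj, hyQ, htu.symm, hyt']),
      valency_sup_edge hyt' (hyQ t), hQ v]
    simp only [Set.mem_insert_iff, Set.mem_singleton_iff]
    grind
  have hxQ₁ := hQ₁d.not_adj (v := x) (by simp)
  have hL : AllOdd (Q₁ ⊔ edge x r ⊔ edge x s) := by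
    have hval : ∀ v, valency (Q₁ ⊔ edge x r ⊔ edge x s) v = 2 := by
      intro v
      rw [valency_sup_edge hxs' (by simp [edge_adj, hxQ₁, hrs.symm, hxr']),
        valency_sup_edge hxr' (hxQ₁ r), hQ₁d v]
      simp only [Set.mem_insert_iff, Set.mem_singleton_iff]
      grind
    refine (hb.odd_avoiding _ ⟨?_, hval⟩ ?_).allOdd fun v => Or.inl (hval v)
    · exact sup_edge_le (sup_edge_le (sup_edge_le (sup_edge_le hQL hyt) hyu) hxr) hxs
    · simp [edge_adj, hxQ₁, hyr, hys, hxr', hxs']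
  have hrs' := hQ₁d.reachable (by simp [hxr'.symm]) rfl
  obtain ⟨hr, hQo⟩ := hL.remove_vertex hxQ₁ hxr' hrs'
  have h1 := allOdd_glue_sum hrs' hab' hQo (fun v _ => hPo v) (hr.add_odd (hPo a))
  set B : SimpleGraph (V ⊕ W) :=
    (Q ⊕g P) ⊔ edge (Sum.inl r) (Sum.inr a) ⊔ edge (Sum.inl s) (Sum.inr b) with hB
  -- The same graph with its edges reordered, so that `y` is now the vertex to be removed.
  have h2 : AllOdd (B ⊔ edge (Sum.inl y) (Sum.inl t) ⊔ edge (Sum.inl y) (Sum.inl u)) := by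
    convert! h1 using 1
    rw [hQ₁, hB, sum_sup_edge_inl, sum_sup_edge_inl]
    ac_rfl
  have hyB : ∀ w, ¬ B.Adj (Sum.inl y) w := by
    rintro (w | w)
    · simp [hB, edge_adj, hyQ]
    · simp [hB, edge_adj, hyr, hys]
  have hBcd : B.Reachable (Sum.inr c) (Sum.inr d) :=
    (reachable_sum_inr_iff.2 hcd').mono (le_sup_left.trans le_sup_left)
  -- The component of `c` cannot leave the side of `R`: in `B` the only exits are at `a` and `b`,
  -- which lie in another component of `P`.
  have hctS : ∀ w, B.Reachable (Sum.inr c) w → ∃ z, w = Sum.inr z ∧ P.Reachable c z := by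
    intro w hw
    refine mem_of_reachable (S := {w | ∃ z, w = Sum.inr z ∧ P.Reachable c z}) ?_
      ⟨c, rfl, Reachable.refl c⟩ hw
    rintro _ ⟨z, rfl, hz⟩ (w | w) hzw
    · simp only [hB, sup_adj, edge_adj] at hzw
      have hza : z ≠ a := by
        rintro rfl
        exact hac' hz.symm
      have hzb : z ≠ b := by
        rintro rfl
        exact hac' (hab'.trans hz.symm)
      simp [hza, hzb] at hzw
    · refine ⟨w, rfl, hz.trans (Adj.reachable ?_)⟩
      simpa [hB, edge_adj] using hzw
  have hBtc : ¬ B.Reachable (Sum.inl t) (Sum.inr c) := by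
    intro h
    obtain ⟨z, hz, -⟩ := hctS _ h.symm
    simp at hz
  -- Adding `cd` to `B` leaves only `t` and `u` odd, and adds no connection because `c` and `d` are
  -- already joined in `P`.
  have hBtu : B.Reachable (Sum.inl t) (Sum.inl u) := by
    have hval : HasDefects (B ⊔ edge (Sum.inr c) (Sum.inr d)) {Sum.inl x, Sum.inl y}
        {Sum.inl t, Sum.inl u} := by
      intro v
      rw [valency_sup_edge (by simpa using hcd) (by simp [hB, edge_adj, hPcd]),
        valency_sup_edge (by simp) (by simp [edge_adj, hrs.symm]),
        valency_sup_edge (by simp) (by simp)]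
      rcases v with v | v
      · rw [valency_sum_inl, hQ v]
        simp only [Set.mem_insert_iff, Set.mem_singleton_iff, Sum.inl.injEq, reduceCtorEq]
        grind
      · rw [valency_sum_inr, hP v]
        simp only [Set.mem_insert_iff, Set.mem_singleton_iff, Sum.inr.injEq, reduceCtorEq]
        grind
    have := hval.reachable (by simp [hxt.symm, hyt'.symm]) rfl
    rwa [reachable_sup_edge_iff_of_reachable hBcd] at this
  obtain ⟨ht, hBo⟩ := h2.remove_vertex hyB (by simpa using hyt') hBtu
  exact AllOdd.of_glue hBtu hBcd hBtc (fun v hv _ => hBo v hv)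
    (ht.add_odd (hBo _ hBtc))

end Cases

/-! ### Symmetries of bold-edges and gadget-pairs -/

theorem IsBoldEdge.symm {L : SimpleGraph V} {x y : V} (h : IsBoldEdge L x y) :
    IsBoldEdge L y x where
  adj := h.adj.symm
  odd_delete_left := h.odd_delete_right
  odd_delete_right := h.odd_delete_left
  odd_containing F hF hxy := h.odd_containing F hF hxy.symm
  odd_avoiding F hF hxy := h.odd_avoiding F hF fun hh => hxy hh.symm

theorem IsTwoFactorWithNewEdge.symm {G H : SimpleGraph V} {p q : V}
    (h : IsTwoFactorWithNewEdge G H p q) : IsTwoFactorWithNewEdge G H q p :=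
  ⟨h.1, h.2.2.1, h.2.1, fun v hq hp => h.2.2.2 v hp hq⟩

namespace IsGadgetPair

variable {R : SimpleGraph W} {a b c d : W}

theorem swap_left (h : IsGadgetPair R a b c d) : IsGadgetPair R b a c d where
  adj_left := h.adj_left.symm
  adj_right := h.adj_right
  independent := ⟨h.independent.2.2.1, h.independent.2.2.2, h.independent.1, h.independent.2.1⟩
  not_avoiding := by simpa only [adj_comm _ b a] using h.not_avoiding
  odd_one := by simpa only [adj_comm _ b a] using h.odd_one
  odd_both := by simpa only [adj_comm _ b a] using h.odd_both
  different_cycles F hF hab hcd v C hC := by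
    rw [Sym2.eq_swap (a := b)]
    exact h.different_cycles F hF hab.symm hcd v C hC
  even_new p q hp hq := by
    rw [Sym2.eq_swap (a := b)]
    exact h.even_new p q hp.symm hq
  odd_old p q hp hq := by
    rw [Sym2.eq_swap (a := b)]
    exact h.odd_old p q hp.symm hq

theorem symm (h : IsGadgetPair R a b c d) : IsGadgetPair R c d a b where
  adj_left := h.adj_right
  adj_right := h.adj_left
  independent := ⟨h.independent.1.symm, h.independent.2.2.1.symm, h.independent.2.1.symm,
    h.independent.2.2.2.symm⟩
  not_avoiding := fun ⟨F, hF, h1, h2⟩ => h.not_avoiding ⟨F, hF, h2, h1⟩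
  odd_one F hF h1 := h.odd_one F hF (by tauto)
  odd_both F hF h1 h2 := h.odd_both F hF h2 h1
  different_cycles F hF h1 h2 v C hC hh := h.different_cycles F hF h2 h1 v C hC hh.symm
  even_new p q hp hq H hH P hP := by
    rw [Set.pair_comm] at hH
    simpa using h.even_new q p hq hp H hH.symm P.reverse hP.reverse
  odd_old p q hp hq H hH := by
    rw [Set.pair_comm] at hH
    exact h.odd_old q p hq hp H hH.symm

theorem swap_right (h : IsGadgetPair R a b c d) : IsGadgetPair R a b d c :=
  h.symm.swap_left.symm

end IsGadgetPair

end BoldGadget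

/-! ### Dissecting a 2-factor of the dot product -/

namespace BoldGadget

open SimpleGraph

variable {V W : Type*}

/-- `xy` is an edge of `L`, the other neighbours of `x` are `r, s`, the other neighbours of `y`
are `t, u`, and these six vertices are distinct. -/
structure IsDotEdge (L : SimpleGraph V) (x y r s t u : V) : Prop where
  adj_left_iff : ∀ w, L.Adj x w ↔ w = y ∨ w = r ∨ w = s
  adj_right_iff : ∀ w, L.Adj y w ↔ w = x ∨ w = t ∨ w = u
  ne_rs : r ≠ s
  ne_tu : t ≠ u
  ne_rt : r ≠ t
  ne_ru : r ≠ u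
  ne_st : s ≠ t
  ne_su : s ≠ u
  ne_yr : y ≠ r
  ne_ys : y ≠ s
  ne_xt : x ≠ t
  ne_xu : x ≠ u

namespace IsDotEdge

variable {L : SimpleGraph V} {x y r s t u : V}

theorem symm (h : IsDotEdge L x y r s t u) : IsDotEdge L y x t u r s where
  adj_left_iff := h.adj_right_iff
  adj_right_iff := h.adj_left_iff
  ne_rs := h.ne_tu
  ne_tu := h.ne_rs
  ne_rt := h.ne_rt.symm
  ne_ru := h.ne_st.symm
  ne_st := h.ne_ru.symm
  ne_su := h.ne_su.symm
  ne_yr := h.ne_xt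
  ne_ys := h.ne_xu
  ne_xt := h.ne_yr
  ne_xu := h.ne_ys

theorem adj (h : IsDotEdge L x y r s t u) : L.Adj x y := (h.adj_left_iff y).2 (by simp)
theorem adj_xr (h : IsDotEdge L x y r s t u) : L.Adj x r := (h.adj_left_iff r).2 (by simp)
theorem adj_xs (h : IsDotEdge L x y r s t u) : L.Adj x s := (h.adj_left_iff s).2 (by simp)
theorem adj_yt (h : IsDotEdge L x y r s t u) : L.Adj y t := (h.adj_right_iff t).2 (by simp)
theorem adj_yu (h : IsDotEdge L x y r s t u) : L.Adj y u := (h.adj_right_iff u).2 (by simp)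

end IsDotEdge

theorem not_triangle_of_egirth {G : SimpleGraph V} (hG : 5 ≤ G.egirth) {p q v : V}
    (h1 : G.Adj p q) (h2 : G.Adj q v) (h3 : G.Adj v p) : False := by
  let C : G.Walk p p := .cons h1 (.cons h2 (.cons h3 .nil))
  have hC : C.IsCycle := by
    simp only [C, Walk.cons_isCycle_iff]
    have := h1.ne
    have := h2.ne
    have := h3.ne
    simp [Walk.isPath_def]
    grind
  have := hG.trans (egirth_le_length hC)
  simp only [C, Walk.length_cons, Walk.length_nil] at this
  exact absurd this (by decide)

theorem not_square_of_egirth {G : SimpleGraph V} (hG : 5 ≤ G.egirth) {p q v w : V}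
    (h1 : G.Adj p q) (h2 : G.Adj q v) (h3 : G.Adj v w) (h4 : G.Adj w p) (hpv : p ≠ v)
    (hqw : q ≠ w) : False := by
  let C : G.Walk p p := .cons h1 (.cons h2 (.cons h3 (.cons h4 .nil)))
  have hC : C.IsCycle := by
    simp only [C, Walk.cons_isCycle_iff]
    have := h1.ne
    have := h2.ne
    have := h3.ne
    have := h4.ne
    simp [Walk.isPath_def]
    grind
  have := hG.trans (egirth_le_length hC)
  simp only [C, Walk.length_cons, Walk.length_nil] at this
  exact absurd this (by decide)

/-- Valency three separates `r` from `s` and `t` from `u`; a coincidence across the two pairs would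
be a triangle on `xy`. -/
theorem IsSnark.isDotEdge [Finite V] {L : SimpleGraph V} {x y r s t u : V} (hL : IsSnark L)
    (hxy : L.Adj x y) (hx : L.neighborSet x \ {y} = {r, s}) (hy : L.neighborSet y \ {x} = {t, u}) :
    IsDotEdge L x y r s t u := by
  have key : ∀ {x y r s : V}, L.Adj x y → L.neighborSet x \ {y} = {r, s} → r ≠ s ∧
      (∀ w, L.Adj x w ↔ w = y ∨ w = r ∨ w = s) ∧ y ≠ r ∧ y ≠ s := by
    intro x y r s hxy hx
    have hmem : ∀ w, (L.Adj x w ∧ w ≠ y) ↔ w = r ∨ w = s := fun w => by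
      have := Set.ext_iff.1 hx w
      simpa using this
    refine ⟨?_, fun w => ?_, ((hmem r).2 (Or.inl rfl)).2.symm, ((hmem s).2 (Or.inr rfl)).2.symm⟩
    · rintro rfl
      have h2 := Set.ncard_sdiff_singleton_of_mem (show y ∈ L.neighborSet x from hxy)
      rw [hx, hL.cubic x] at h2
      simp at h2
    · rw [← hmem]
      by_cases hw : w = y
      · simp [hw, hxy]
      · simp [hw]
  obtain ⟨h1, h2, h3, h4⟩ := key hxy hx
  obtain ⟨h5, h6, h7, h8⟩ := key hxy.symm hy
  have htri : ∀ w, L.Adj x w → L.Adj y w → False := fun w hw hw' =>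
    not_triangle_of_egirth hL.girth hxy hw' hw.symm
  exact {
    adj_left_iff := h2
    adj_right_iff := h6
    ne_rs := h1
    ne_tu := h5
    ne_rt := by
      rintro rfl
      exact htri r ((h2 r).2 (by simp)) ((h6 r).2 (by simp))
    ne_ru := by
      rintro rfl
      exact htri r ((h2 r).2 (by simp)) ((h6 r).2 (by simp))
    ne_st := by
      rintro rfl
      exact htri s ((h2 s).2 (by simp)) ((h6 s).2 (by simp))
    ne_su := by
      rintro rfl
      exact htri s ((h2 s).2 (by simp)) ((h6 s).2 (by simp))
    ne_yr := h3
    ne_ys := h4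
    ne_xt := h7
    ne_xu := h8 }

theorem valency_inl [Finite V] [Finite W] (K : SimpleGraph (V ⊕ W)) (v : V) :
    valency K (Sum.inl v) =
      valency (K.comap Sum.inl) v + {w | K.Adj (Sum.inl v) (Sum.inr w)}.ncard := by
  unfold valency
  rw [← Set.ncard_image_of_injective ((K.comap Sum.inl).neighborSet v) (Sum.inl_injective (β := W)),
    ← Set.ncard_image_of_injective {w | K.Adj (Sum.inl v) (Sum.inr w)}
      (Sum.inr_injective (α := V)), ← Set.ncard_union_eq _ (Set.toFinite _) (Set.toFinite _)]
  · congr 1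
    ext (w | w) <;> simp
  · rw [Set.disjoint_left]
    rintro _ ⟨w, -, rfl⟩ ⟨w', -, h⟩
    cases h

theorem valency_inr [Finite V] [Finite W] (K : SimpleGraph (V ⊕ W)) (w : W) :
    valency K (Sum.inr w) =
      valency (K.comap Sum.inr) w + {v | K.Adj (Sum.inl v) (Sum.inr w)}.ncard := by
  unfold valency
  rw [← Set.ncard_image_of_injective ((K.comap Sum.inr).neighborSet w) (Sum.inr_injective (α := V)),
    ← Set.ncard_image_of_injective {v | K.Adj (Sum.inl v) (Sum.inr w)}
      (Sum.inl_injective (β := W)), ← Set.ncard_union_eq _ (Set.toFinite _) (Set.toFinite _)]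
  · congr 1
    ext (v | v) <;> simp [adj_comm]
  · rw [Set.disjoint_left]
    rintro _ ⟨w, -, rfl⟩ ⟨w', -, h⟩
    cases h

open Classical in
theorem ncard_eq_ite_of_subsingleton {S : Set V} (hS : S.Subsingleton) :
    S.ncard = if S.Nonempty then 1 else 0 := by
  rcases hS.eq_empty_or_singleton with rfl | ⟨v, rfl⟩ <;> simp

/-- `K` is a `2`-factor of the dot product, seen as a graph on `V ⊕ W` in which the deleted
vertices `x` and `y` are isolated. -/
structure IsDotFactor (L : SimpleGraph V) (x y r s t u : V) (R : SimpleGraph W) (a b c d : W)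
    (K : SimpleGraph (V ⊕ W)) : Prop where
  left_le : K.comap Sum.inl ≤ L
  right_le : K.comap Sum.inr ≤ R.deleteEdges {s(a, b), s(c, d)}
  join : ∀ v w, K.Adj (Sum.inl v) (Sum.inr w) →
    v = r ∧ w = a ∨ v = s ∧ w = b ∨ v = t ∧ w = c ∨ v = u ∧ w = d
  defects : HasDefects K {Sum.inl x, Sum.inl y} ∅

section

variable {L : SimpleGraph V} {R : SimpleGraph W} {x y r s t u : V} {a b c d : W}

/-- The vertices of a dot product, as elements of `V ⊕ W`. -/
def dotEmbedding (x y : V) (W : Type*) : (({x, y}ᶜ : Set V) ⊕ W) ↪ V ⊕ W :=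
  (Function.Embedding.subtype _).sumMap (Function.Embedding.refl W)

theorem dotProduct_adj_inl_inl {v w : ({x, y}ᶜ : Set V)} :
    (dotProduct L x y r s t u R a b c d).Adj (Sum.inl v) (Sum.inl w) ↔ L.Adj v w := by
  simp [dotProduct, joiningEdges]

theorem dotProduct_adj_inr_inr {v w : W} :
    (dotProduct L x y r s t u R a b c d).Adj (Sum.inr v) (Sum.inr w) ↔
      (R.deleteEdges {s(a, b), s(c, d)}).Adj v w := by
  simp [dotProduct, joiningEdges]

theorem dotProduct_adj_inl_inr {v : ({x, y}ᶜ : Set V)} {w : W} :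
    (dotProduct L x y r s t u R a b c d).Adj (Sum.inl v) (Sum.inr w) ↔
      (v : V) = r ∧ w = a ∨ (v : V) = s ∧ w = b ∨ (v : V) = t ∧ w = c ∨ (v : V) = u ∧ w = d := by
  simp only [dotProduct, joiningEdges, sup_adj, not_adj_sum_inl_inr, fromRel_adj, false_or]
  constructor
  · rintro ⟨-, ⟨v', w', h1, h2, h⟩ | ⟨v', w', h1, -⟩⟩
    · cases h1
      cases h2
      exact h
    · cases h1
  · exact fun h => ⟨by simp, Or.inl ⟨v, w, rfl, rfl, h⟩⟩

end

section

variable [Finite V] [Finite W] {L : SimpleGraph V} {R : SimpleGraph W} {x y r s t u : V}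
  {a b c d : W} {K : SimpleGraph (V ⊕ W)}

/-- The joining edges form a matching, so a vertex of the trace misses at most one of its two edges.
-/
theorem IsDotFactor.hasDefects_left (hD : IsDotEdge L x y r s t u)
    (hK : IsDotFactor L x y r s t u R a b c d K) :
    HasDefects (K.comap Sum.inl) {x, y} {v | ∃ w, K.Adj (Sum.inl v) (Sum.inr w)} := by
  classical
  intro v
  have h := valency_inl K v
  have hs : {w | K.Adj (Sum.inl v) (Sum.inr w)}.Subsingleton := by
    intro w hw w' hw'
    have h1 := hK.join v w hw
    have h2 := hK.join v w' hw'
    have := hD.ne_rs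
    have := hD.ne_tu
    have := hD.ne_rt
    have := hD.ne_ru
    have := hD.ne_st
    have := hD.ne_su
    grind
  rw [ncard_eq_ite_of_subsingleton hs, hK.defects] at h
  simp only [Set.mem_insert_iff, Set.mem_singleton_iff, Sum.inl.injEq, Set.mem_empty_iff_false,
    Set.Nonempty, Set.mem_ofPred_eq] at h ⊢
  split_ifs at h ⊢ <;> simp_all

theorem IsDotFactor.hasDefects_right (hg : IsGadgetPair R a b c d)
    (hK : IsDotFactor L x y r s t u R a b c d K) :
    HasDefects (K.comap Sum.inr) ∅ {w | ∃ v, K.Adj (Sum.inl v) (Sum.inr w)} := by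
  classical
  intro w
  have h := valency_inr K w
  have hs : {v | K.Adj (Sum.inl v) (Sum.inr w)}.Subsingleton := by
    intro v hv v' hv'
    have h1 := hK.join v w hv
    have h2 := hK.join v' w hv'
    have := hg.independent
    have := hg.adj_left.ne
    have := hg.adj_right.ne
    grind
  rw [ncard_eq_ite_of_subsingleton hs, hK.defects] at h
  simp only [Set.mem_insert_iff, Set.mem_singleton_iff, Set.mem_empty_iff_false,
    Set.Nonempty, Set.mem_ofPred_eq, reduceCtorEq] at h ⊢
  split_ifs at h ⊢ <;> simp_all

/-- A case split over the sixteen sets of joining edges. Sets of odd size fail by handshaking on the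
side of `L`, the empty set fails by `not_avoiding`, and the others are the three gluing lemmas up to
the symmetries of the pairs. -/
theorem IsDotFactor.allOdd (hb : IsBoldEdge L x y) (hD : IsDotEdge L x y r s t u)
    (hg : IsGadgetPair R a b c d) (hK : IsDotFactor L x y r s t u R a b c d K) : AllOdd K := by
  have hQ := hK.hasDefects_left hD
  have hP := hK.hasDefects_right hg
  have hQL := hK.left_le
  have hPR := hK.right_le
  have hj : ∀ v w, K.Adj (Sum.inl v) (Sum.inr w) ↔
      v = r ∧ w = a ∧ K.Adj (Sum.inl r) (Sum.inr a) ∨ v = s ∧ w = b ∧ K.Adj (Sum.inl s) (Sum.inr b) ∨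
      v = t ∧ w = c ∧ K.Adj (Sum.inl t) (Sum.inr c) ∨
      v = u ∧ w = d ∧ K.Adj (Sum.inl u) (Sum.inr d) := by
    intro v w
    constructor
    · intro h
      rcases hK.join v w h with ⟨rfl, rfl⟩ | ⟨rfl, rfl⟩ | ⟨rfl, rfl⟩ | ⟨rfl, rfl⟩ <;> tauto
    · rintro (⟨rfl, rfl, h⟩ | ⟨rfl, rfl, h⟩ | ⟨rfl, rfl, h⟩ | ⟨rfl, rfl, h⟩) <;> exact h
  have hJ : {v | ∃ w, K.Adj (Sum.inl v) (Sum.inr w)} = {v |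
      v = r ∧ K.Adj (Sum.inl r) (Sum.inr a) ∨ v = s ∧ K.Adj (Sum.inl s) (Sum.inr b) ∨
      v = t ∧ K.Adj (Sum.inl t) (Sum.inr c) ∨ v = u ∧ K.Adj (Sum.inl u) (Sum.inr d)} := by
    ext v
    constructor
    · rintro ⟨w, h⟩
      rcases (hj v w).1 h with h | h | h | h <;> simp [h.1, h.2.2]
    · rintro (⟨rfl, h⟩ | ⟨rfl, h⟩ | ⟨rfl, h⟩ | ⟨rfl, h⟩) <;> exact ⟨_, h⟩
  have hJ' : {w | ∃ v, K.Adj (Sum.inl v) (Sum.inr w)} = {w |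
      w = a ∧ K.Adj (Sum.inl r) (Sum.inr a) ∨ w = b ∧ K.Adj (Sum.inl s) (Sum.inr b) ∨
      w = c ∧ K.Adj (Sum.inl t) (Sum.inr c) ∨ w = d ∧ K.Adj (Sum.inl u) (Sum.inr d)} := by
    ext w
    constructor
    · rintro ⟨v, h⟩
      rcases (hj v w).1 h with h | h | h | h <;> simp [h.2.1, h.2.2]
    · rintro (⟨rfl, h⟩ | ⟨rfl, h⟩ | ⟨rfl, h⟩ | ⟨rfl, h⟩) <;> exact ⟨_, h⟩
  have heven := even_ncard_odd_valency (K.comap Sum.inl)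
  simp only [hQ.odd_iff] at heven
  rw [show {v | v ∉ ({x, y} : Set V) ∧ v ∈ {v | ∃ w, K.Adj (Sum.inl v) (Sum.inr w)}} =
      {v | ∃ w, K.Adj (Sum.inl v) (Sum.inr w)} by
    ext v
    simp only [Set.mem_ofPred_eq, and_iff_right_iff_imp]
    rintro ⟨w, hw⟩ (rfl | rfl)
    exacts [hK.defects.not_adj (by simp) _ hw, hK.defects.not_adj (by simp) _ hw], hJ] at heven
  rw [hJ] at hQ
  rw [hJ'] at hP
  have hone : ∀ v, ¬ Even ({v} : Set V).ncard := by simp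
  have hthree : ∀ v w z : V, v ≠ w → v ≠ z → w ≠ z → ¬ Even ({v, w, z} : Set V).ncard := by
    intro v w z h1 h2 h3
    rw [Set.ncard_eq_three.2 ⟨v, w, z, h1, h2, h3, rfl⟩]
    decide
  have hK' : ∀ v w, K.Adj (Sum.inr w) (Sum.inl v) ↔ K.Adj (Sum.inl v) (Sum.inr w) :=
    fun v w => adj_comm _ _ _
  have hxr := hD.adj_xr
  have hxs := hD.adj_xs
  have hyt := hD.adj_yt
  have hyu := hD.adj_yu
  obtain ⟨-, -, hrs, htu, hrt, hru, hst, hsu, hyr, hys, hxt, hxu⟩ := hD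
  by_cases h1 : K.Adj (Sum.inl r) (Sum.inr a) <;>
  by_cases h2 : K.Adj (Sum.inl s) (Sum.inr b) <;>
  by_cases h3 : K.Adj (Sum.inl t) (Sum.inr c) <;>
  by_cases h4 : K.Adj (Sum.inl u) (Sum.inr d) <;>
  simp only [h1, h2, h3, h4, and_true, and_false, or_false, false_or] at hQ hP hj heven
  · convert! allOdd_of_four hb hxr hxs hyt hyu hrs htu hrt hru hst hsu hyr hys hxt hxu hQL hQ hg
      hPR hP using 1
    ext (v | v) (w | w) <;> simp [edge_adj, hj, hK', and_comm, or_assoc]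
  · exact absurd heven (hthree r s t hrs hrt hst)
  · exact absurd heven (hthree r s u hrs hru hsu)
  · convert! allOdd_of_same_side hb hxr hxs hrs hyr hys hQL hQ hg hPR hP using 1
    ext (v | v) (w | w) <;> simp [edge_adj, hj, hK', and_comm]
  · exact absurd heven (hthree r t u hrt hru htu)
  · convert! allOdd_of_both_sides hb hxr hyt hrt hyr hxt hQL hQ hg hPR hP using 1
    ext (v | v) (w | w) <;> simp [edge_adj, hj, hK', and_comm]
  · have hg' := hg.swap_right
    rw [Sym2.eq_swap (a := c)] at hPR
    convert! allOdd_of_both_sides hb hxr hyu hru hyr hxu hQL hQ hg' hPR hP using 1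
    ext (v | v) (w | w) <;> simp [edge_adj, hj, hK', and_comm]
  · exact absurd heven (hone r)
  · exact absurd heven (hthree s t u hst hsu htu)
  · have hg' := hg.swap_left
    rw [Sym2.eq_swap (a := a)] at hPR
    convert! allOdd_of_both_sides hb hxs hyt hst hys hxt hQL hQ hg' hPR hP using 1
    ext (v | v) (w | w) <;> simp [edge_adj, hj, hK', and_comm]
  · have hg' := hg.swap_left.swap_right
    rw [Sym2.eq_swap (a := a), Sym2.eq_swap (a := c)] at hPR
    convert! allOdd_of_both_sides hb hxs hyu hsu hys hxu hQL hQ hg' hPR hP using 1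
    ext (v | v) (w | w) <;> simp [edge_adj, hj, hK', and_comm]
  · exact absurd heven (hone s)
  · rw [Set.pair_comm] at hPR hQ
    convert! allOdd_of_same_side hb.symm hyt hyu htu hxt hxu hQL hQ hg.symm hPR hP using 1
    ext (v | v) (w | w) <;> simp [edge_adj, hj, hK', and_comm]
  · exact absurd heven (hone t)
  · exact absurd heven (hone u)
  · exact (hg.not_avoiding ⟨K.comap Sum.inr, ⟨hPR.trans (deleteEdges_le _), fun v =>
      (hP v).trans (by simp)⟩, fun h => by simpa using hPR h, fun h => by simpa using hPR h⟩).elim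

theorem IsTwoFactor.isDotFactor {F : SimpleGraph (({x, y}ᶜ : Set V) ⊕ W)}
    (hF : IsTwoFactor (dotProduct L x y r s t u R a b c d) F) :
    IsDotFactor L x y r s t u R a b c d (F.map (dotEmbedding x y W)) where
  left_le := by
    rintro v w ⟨-, (v' | v'), (w' | w'), h, h1, h2⟩
    · cases h1
      cases h2
      exact dotProduct_adj_inl_inl.1 (hF.1 h)
    all_goals simp [dotEmbedding] at h1 h2
  right_le := by
    rintro v w ⟨-, (v' | v'), (w' | w'), h, h1, h2⟩
    · simp [dotEmbedding] at h1
    · simp [dotEmbedding] at h1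
    · simp [dotEmbedding] at h2
    · cases h1
      cases h2
      exact dotProduct_adj_inr_inr.1 (hF.1 h)
  join := by
    rintro v w ⟨-, (v' | v'), (w' | w'), h, h1, h2⟩
    · simp [dotEmbedding] at h2
    · cases h1
      cases h2
      exact dotProduct_adj_inl_inr.1 (hF.1 h)
    all_goals simp [dotEmbedding] at h1 h2
  defects := by
    classical
    intro v
    have hin : ∀ z, valency (F.map (dotEmbedding x y W)) (dotEmbedding x y W z) = 2 := fun z => by
      rw [valency_map]
      exact hF.2 z
    rcases v with v | w
    · by_cases hv : v = x ∨ v = y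
      · rw [if_pos (by simpa using hv), valency_eq_zero_iff]
        rintro w ⟨-, (z | z), z', h, h1, -⟩
        · exact z.2 (by cases h1; exact hv)
        · cases h1
      · rw [if_neg (by simpa using hv), if_neg (by simp)]
        exact hin (Sum.inl ⟨v, hv⟩)
    · rw [if_neg (by simp), if_neg (by simp)]
      exact hin (Sum.inr w)

theorem isOddTwoFactored_dotProduct (hb : IsBoldEdge L x y) (hD : IsDotEdge L x y r s t u)
    (hg : IsGadgetPair R a b c d) :
    IsOddTwoFactored (dotProduct L x y r s t u R a b c d) := by
  intro F hF
  refine AllOdd.isOdd (fun v => ?_) hF.2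
  rw [← compCard_map F (dotEmbedding x y W)]
  exact hF.isDotFactor.allOdd hb hD hg _

end

end BoldGadget

/-! ### Edge cuts in cubic graphs -/

namespace BoldGadget

open SimpleGraph

variable {V W : Type*}

/-- The number of edges of `G` between `A` and its complement. -/
noncomputable def cutSize (G : SimpleGraph V) (A : Set V) : ℕ :=
  {z : V × V | z.1 ∈ A ∧ z.2 ∉ A ∧ G.Adj z.1 z.2}.ncard

/-- Every edge cut of size at most three isolates at most one vertex. -/
def HasOnlyTrivialThreeCuts (G : SimpleGraph V) : Prop :=
  ∀ A : Set V, 2 ≤ A.ncard → 2 ≤ Aᶜ.ncard → 4 ≤ cutSize G A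

theorem cutSize_compl (G : SimpleGraph V) (A : Set V) : cutSize G Aᶜ = cutSize G A := by
  unfold cutSize
  rw [← Set.ncard_image_of_injective _ (Prod.swap_injective (α := V) (β := V))]
  congr 1
  ext ⟨v, w⟩
  simp only [Set.image_swap_eq_preimage_swap, Set.mem_preimage, Prod.swap_prod_mk,
    Set.mem_ofPred_eq, Set.mem_compl_iff, not_not, adj_comm _ w v]
  tauto

theorem ncard_sigma_eq [Finite V] (A : Set V) (p : V → V → Prop) :
    {z : V × V | z.1 ∈ A ∧ p z.1 z.2}.ncard = ∑ᶠ v : A, {w | p v w}.ncard := by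
  have := Fintype.ofFinite A
  rw [finsum_eq_sum_of_fintype, ← Nat.card_coe_set_eq]
  simp only [← Nat.card_coe_set_eq]
  rw [← Nat.card_sigma]
  refine Nat.card_congr ⟨fun z => ⟨⟨z.1.1, z.2.1⟩, ⟨z.1.2, z.2.2⟩⟩,
    fun z => ⟨(z.1.1, z.2.1), z.1.2, z.2.2⟩, fun _ => rfl, fun _ => rfl⟩

theorem valency_induce [Finite V] (G : SimpleGraph V) (A : Set V) (v : A) :
    valency (G.induce A) v + {w | w ∉ A ∧ G.Adj v w}.ncard = valency G v := by
  unfold valency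
  rw [← Set.ncard_image_of_injective _ (Subtype.val_injective (p := (· ∈ A))),
    ← Set.ncard_union_eq _ (Set.toFinite _) (Set.toFinite _)]
  · congr 1
    ext w
    by_cases hw : w ∈ A <;> simp [hw]
  · rw [Set.disjoint_left]
    rintro _ ⟨w, -, rfl⟩ ⟨h, -⟩
    exact h w.2

/-- A forest on `n` vertices has at most `n - 1` edges, so at least `3n - 2(n - 1) = n + 2` of the
edge ends at `A` lead outside. -/
theorem add_two_le_cutSize_of_isAcyclic [Finite V] {G : SimpleGraph V} (h3 : ∀ v, valency G v = 3)
    {A : Set V} (hA : A.Nonempty) (hac : (G.induce A).IsAcyclic) : A.ncard + 2 ≤ cutSize G A := by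
  classical
  have := Fintype.ofFinite V
  have : Nonempty A := hA.to_subtype
  obtain ⟨T, hle, -, hT⟩ := (connected_top (V := A)).exists_isTree_le_of_le_of_isAcyclic le_top hac
  have hcard := hT.card_edgeFinset
  have hle' := Finset.card_le_card (edgeFinset_mono hle)
  have hsum := (G.induce A).sum_degrees_eq_twice_card_edges
  have hcut : cutSize G A = ∑ v : A, {w | w ∉ A ∧ G.Adj v w}.ncard := by
    rw [← finsum_eq_sum_of_fintype, ← ncard_sigma_eq A fun v w => w ∉ A ∧ G.Adj v w]
    rfl
  have htot : ∑ v : A, (valency (G.induce A) v + {w | w ∉ A ∧ G.Adj v w}.ncard) =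
      3 * Fintype.card A := by
    simp only [valency_induce, h3]
    simp [mul_comm]
  rw [Finset.sum_add_distrib, ← hcut] at htot
  simp only [degree_eq_valency] at hsum
  rw [← Nat.card_coe_set_eq, Nat.card_eq_fintype_card]
  omega

theorem mem_of_reachable_deleteEdges_cut {G : SimpleGraph V} {A : Set V} {v w : V}
    (h : (G.deleteEdges ((fun z : V × V => s(z.1, z.2)) ''
      {z : V × V | z.1 ∈ A ∧ z.2 ∉ A ∧ G.Adj z.1 z.2})).Reachable v w) (hv : v ∈ A) : w ∈ A := by
  refine mem_of_reachable (fun a ha b hab => ?_) hv h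
  rw [deleteEdges_adj] at hab
  by_contra hb
  exact hab.2 ⟨(a, b), ⟨ha, hb, hab.1⟩, rfl⟩

/-- A side with at least two vertices and a cut below four contains a cycle, since an acyclic one
would have cut at least `2 + 2`. Cycles on both sides contradict cyclic connectivity. -/
theorem IsSnark.hasOnlyTrivialThreeCuts [Finite V] {G : SimpleGraph V} (hG : IsSnark G) :
    HasOnlyTrivialThreeCuts G := by
  intro A hA hA'
  by_contra! hlt
  set S := (fun z : V × V => s(z.1, z.2)) '' {z : V × V | z.1 ∈ A ∧ z.2 ∉ A ∧ G.Adj z.1 z.2}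
    with hS
  have hcyc : ∀ B : Set V, 2 ≤ B.ncard → cutSize G B < 4 → (∀ v ∈ B, ∀ w ∈ B, s(v, w) ∉ S) →
      ∃ v ∈ B, ∃ C : (G.deleteEdges S).Walk v v, C.IsCycle := by
    intro B hB hlt hBS
    have hne : B.Nonempty := by
      rw [← Set.ncard_pos]
      omega
    have hac : ¬ (G.induce B).IsAcyclic := fun hac => by
      have := add_two_le_cutSize_of_isAcyclic hG.cubic hne hac
      omega
    simp only [IsAcyclic, not_forall, not_not] at hac
    obtain ⟨v, C, hC⟩ := hac
    let f : G.induce B →g G.deleteEdges S :=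
      ⟨Subtype.val, fun {p q} h => by
        rw [deleteEdges_adj]
        exact ⟨h, hBS p p.2 q q.2⟩⟩
    exact ⟨v, v.2, C.map f, hC.map Subtype.val_injective⟩
  obtain ⟨v, hv, C, hC⟩ := hcyc A hA hlt (by
    rintro v hv w hw ⟨z, ⟨h1, h2, -⟩, h⟩
    simp only [Sym2.eq_iff] at h
    rcases h with ⟨rfl, rfl⟩ | ⟨rfl, rfl⟩
    exacts [h2 hw, h2 hv])
  obtain ⟨w, hw, D, hD⟩ := hcyc Aᶜ hA' (by rwa [cutSize_compl]) (by
    rintro v hv w hw ⟨z, ⟨h1, h2, -⟩, h⟩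
    simp only [Sym2.eq_iff] at h
    rcases h with ⟨rfl, rfl⟩ | ⟨rfl, rfl⟩
    exacts [hv h1, hw h1])
  refine hw (mem_of_reachable_deleteEdges_cut (hG.cyclically_four_edge_connected S ?_ ?_ v w C D
    hC hD) hv)
  · rintro _ ⟨z, hz, rfl⟩
    exact hz.2.2
  · refine (Set.encard_image_le _ _).trans_lt ?_
    rw [← Set.Finite.cast_ncard_eq (Set.toFinite _)]
    exact_mod_cast hlt

theorem cutSize_singleton [Finite V] (G : SimpleGraph V) (v : V) :
    cutSize G {v} = valency G v := by
  unfold cutSize valency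
  rw [← Set.ncard_image_of_injective (G.neighborSet v) (Prod.mk_right_injective v)]
  congr 1
  ext ⟨p, q⟩
  simp only [Set.mem_singleton_iff, Set.mem_ofPred_eq, Set.mem_image, mem_neighborSet,
    Prod.mk.injEq]
  constructor
  · rintro ⟨rfl, h1, h2⟩
    exact ⟨q, h2, rfl, rfl⟩
  · rintro ⟨q, h, rfl, rfl⟩
    exact ⟨rfl, h.ne', h⟩

theorem HasOnlyTrivialThreeCuts.three_le [Finite V] {G : SimpleGraph V}
    (hG : HasOnlyTrivialThreeCuts G) (h3 : ∀ v, valency G v = 3) {A : Set V} (hA : A.Nonempty)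
    (hA' : Aᶜ.Nonempty) : 3 ≤ cutSize G A := by
  have h1 := (Set.ncard_pos (Set.toFinite _)).2 hA
  have h2 := (Set.ncard_pos (Set.toFinite _)).2 hA'
  by_cases hA1 : A.ncard = 1
  · obtain ⟨v, rfl⟩ := Set.ncard_eq_one.1 hA1
    rw [cutSize_singleton, h3]
  by_cases hA2 : Aᶜ.ncard = 1
  · obtain ⟨v, hv⟩ := Set.ncard_eq_one.1 hA2
    rw [← cutSize_compl, hv, cutSize_singleton, h3]
  · exact le_trans (by norm_num) (hG A (by omega) (by omega))

theorem cutSize_le_ncard [Finite V] {G : SimpleGraph V} {A : Set V} {S : Set (Sym2 V)}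
    (h : ∀ v ∈ A, ∀ w ∉ A, G.Adj v w → s(v, w) ∈ S) : cutSize G A ≤ S.ncard := by
  refine Set.ncard_le_ncard_of_injOn (fun z => s(z.1, z.2)) ?_ ?_ (Set.toFinite _)
  · rintro ⟨p, q⟩ ⟨hp, hq, hpq⟩
    exact h p hp q hq hpq
  · rintro ⟨p, q⟩ ⟨hp, hq, -⟩ ⟨p', q'⟩ ⟨hp', hq', -⟩ h
    simp only [Sym2.eq_iff] at h
    rcases h with ⟨rfl, rfl⟩ | ⟨rfl, rfl⟩
    exacts [rfl, (hq hp').elim]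

theorem cutSize_reachable_le [Finite V] {G : SimpleGraph V} (S : Set (Sym2 V)) (v : V) :
    cutSize G {w | (G.deleteEdges S).Reachable v w} ≤ S.ncard := by
  refine cutSize_le_ncard fun p hp q hq hpq => ?_
  by_contra hS
  exact hq (Reachable.trans hp (Adj.reachable (deleteEdges_adj.2 ⟨hpq, hS⟩)))

namespace HasOnlyTrivialThreeCuts

variable [Finite V] {G : SimpleGraph V}

theorem reachable_deleteEdges (hG : HasOnlyTrivialThreeCuts G) (h3 : ∀ v, valency G v = 3)
    {S : Set (Sym2 V)} (hS : S.ncard ≤ 2) (v w : V) : (G.deleteEdges S).Reachable v w := by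
  by_contra h
  have h1 := hG.three_le h3 (A := {w | (G.deleteEdges S).Reachable v w}) ⟨v, Reachable.refl v⟩
    ⟨w, h⟩
  have h2 := cutSize_reachable_le (G := G) S v
  omega

theorem connected (hG : HasOnlyTrivialThreeCuts G) (h3 : ∀ v, valency G v = 3) [Nonempty V] :
    G.Connected where
  preconnected v w := (hG.reachable_deleteEdges h3 (S := ∅) (by simp) v w).mono (deleteEdges_le _)

theorem not_isBridge (hG : HasOnlyTrivialThreeCuts G) (h3 : ∀ v, valency G v = 3) (e : Sym2 V) :
    ¬ G.IsBridge e := by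
  induction e with
  | h v w =>
    rw [isBridge_iff, not_not]
    exact hG.reachable_deleteEdges h3 (by simp) v w

/-- The component of `v` after deleting `S` has its cut inside `S`, and a cycle on each side
supplies the two vertices needed there. -/
theorem isCyclicallyEdgeConnected (hG : HasOnlyTrivialThreeCuts G) :
    IsCyclicallyEdgeConnected G 4 := by
  intro S _ hS v w C D hC hD
  have hS' : S.ncard < 4 := by
    rw [← Set.Finite.cast_ncard_eq (Set.toFinite _)] at hS
    exact_mod_cast hS
  by_contra h
  have htwo : ∀ (K : SimpleGraph V) (v : V) (C : K.Walk v v), C.IsCycle →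
      2 ≤ {w | K.Reachable v w}.ncard := by
    intro K v C hC
    have hadj := C.adj_snd hC.not_nil
    rw [← Set.ncard_pair hadj.ne]
    refine Set.ncard_le_ncard ?_ (Set.toFinite _)
    rintro z (rfl | rfl)
    exacts [Reachable.refl _, hadj.reachable]
  have h1 := hG {w | (G.deleteEdges S).Reachable v w} (htwo _ v C hC)
    ((htwo _ w D hD).trans (Set.ncard_le_ncard
      (fun z hz hz' => h (Reachable.trans hz' (Reachable.symm hz))) (Set.toFinite _)))
  have h2 := cutSize_reachable_le (G := G) S v
  omega

end HasOnlyTrivialThreeCuts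

end BoldGadget

/-! ### Girth and valencies of the dot product -/

namespace BoldGadget

open SimpleGraph

variable {V W : Type*}

theorem five_le_egirth {G : SimpleGraph V}
    (h3 : ∀ p q v, G.Adj p q → G.Adj q v → G.Adj v p → False)
    (h4 : ∀ p q v w, G.Adj p q → G.Adj q v → G.Adj v w → G.Adj w p → p ≠ v → q ≠ w → False) :
    5 ≤ G.egirth := by
  rw [show (5 : ℕ∞) = ((5 : ℕ) : ℕ∞) from rfl, le_egirth]
  intro p C hC
  have h := hC.three_le_length
  by_contra hlt
  rw [Nat.cast_le] at hlt
  match C with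
  | .cons h1 (.cons h2 (.cons h3' .nil)) => exact h3 _ _ _ h1 h2 h3'
  | .cons (v := q) h1 (.cons (v := v) h2 (.cons (v := w) h3' (.cons h4' .nil))) =>
    have := hC.support_nodup
    simp only [Walk.support_cons, Walk.support_nil, List.tail_cons, List.nodup_cons,
      List.mem_cons] at this
    exact h4 _ _ _ _ h1 h2 h3' h4' (by tauto) (by tauto)
  | .nil => simp at h
  | .cons h1 .nil => simp at h
  | .cons h1 (.cons h2 .nil) => simp at h
  | .cons h1 (.cons h2 (.cons h3' (.cons h4' (.cons h5 p)))) =>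
    simp only [Walk.length_cons] at hlt
    omega

section

variable {L : SimpleGraph V} {R : SimpleGraph W} {x y r s t u : V} {a b c d : W}

/-- Such an edge would close a triangle through `x` or `y`, or a square through `xy`. -/
theorem IsDotEdge.not_adj_of_mem (hD : IsDotEdge L x y r s t u) (hL : 5 ≤ L.egirth) {v w : V}
    (hv : v = r ∨ v = s ∨ v = t ∨ v = u) (hw : w = r ∨ w = s ∨ w = t ∨ w = u) : ¬ L.Adj v w := by
  have hxy := hD.adj
  have key : ∀ v : V, v = r ∨ v = s ∨ v = t ∨ v = u →
      L.Adj x v ∧ y ≠ v ∨ L.Adj y v ∧ x ≠ v := by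
    rintro v (rfl | rfl | rfl | rfl)
    exacts [Or.inl ⟨hD.adj_xr, hD.ne_yr⟩, Or.inl ⟨hD.adj_xs, hD.ne_ys⟩,
      Or.inr ⟨hD.adj_yt, hD.ne_xt⟩, Or.inr ⟨hD.adj_yu, hD.ne_xu⟩]
  intro hvw
  rcases key v hv with ⟨h1, h1'⟩ | ⟨h1, h1'⟩ <;> rcases key w hw with ⟨h2, h2'⟩ | ⟨h2, h2'⟩
  · exact not_triangle_of_egirth hL h1 hvw h2.symm
  · exact not_square_of_egirth hL h1 hvw h2.symm hxy.symm h2' h1'.symm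
  · exact not_square_of_egirth hL h1 hvw h2.symm hxy h2' h1'.symm
  · exact not_triangle_of_egirth hL h1 hvw h2.symm

/-- A triangle or square meeting both sides would have two joining edges sharing an end, or two
whose ends in `L` are adjacent. The joining edges form a matching with pairwise nonadjacent ends in
`L`. -/
theorem five_le_egirth_dotProduct (hL : 5 ≤ L.egirth) (hR : 5 ≤ R.egirth)
    (hD : IsDotEdge L x y r s t u) (hi : a ≠ b ∧ a ≠ c ∧ a ≠ d ∧ b ≠ c ∧ b ≠ d ∧ c ≠ d) :
    5 ≤ (dotProduct L x y r s t u R a b c d).egirth := by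
  set G := dotProduct L x y r s t u R a b c d with hG
  have hll : ∀ {v w}, G.Adj (Sum.inl v) (Sum.inl w) → L.Adj v w := dotProduct_adj_inl_inl.1
  have hrr : ∀ {v w}, G.Adj (Sum.inr v) (Sum.inr w) → R.Adj v w := fun h =>
    (deleteEdges_adj.1 (dotProduct_adj_inr_inr.1 h)).1
  have hlr : ∀ {v w}, G.Adj (Sum.inl v) (Sum.inr w) → (v : V) = r ∧ w = a ∨ (v : V) = s ∧ w = b ∨
    (v : V) = t ∧ w = c ∨ (v : V) = u ∧ w = d := dotProduct_adj_inl_inr.1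
  have hjoin : ∀ {v w}, G.Adj (Sum.inl v) (Sum.inr w) →
      (v : V) = r ∨ (v : V) = s ∨ (v : V) = t ∨ (v : V) = u := fun h => by
    have := hlr h
    tauto
  have hL2 : ∀ {v v' w w'}, G.Adj (Sum.inl v) (Sum.inr w) → G.Adj (Sum.inl v') (Sum.inr w') →
      ¬ G.Adj (Sum.inl v) (Sum.inl v') := fun h1 h2 h3 =>
    hD.not_adj_of_mem hL (hjoin h1) (hjoin h2) (hll h3)
  have huniq : ∀ {v w w'}, G.Adj (Sum.inl v) (Sum.inr w) → G.Adj (Sum.inl v) (Sum.inr w') →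
      w = w' := by
    intro v w w' h1 h2
    have h1 := hlr h1
    have h2 := hlr h2
    obtain ⟨-, -, hrs, htu, hrt, hru, hst, hsu, -⟩ := hD
    grind
  have huniq' : ∀ {v v' w}, G.Adj (Sum.inl v) (Sum.inr w) → G.Adj (Sum.inl v') (Sum.inr w) →
      v = v' := by
    intro v v' w h1 h2
    have h1 := hlr h1
    have h2 := hlr h2
    apply Subtype.ext
    grind
  refine five_le_egirth ?_ ?_
  · rintro (p | p) (q | q) (v | v) h1 h2 h3
    · exact not_triangle_of_egirth hL (hll h1) (hll h2) (hll h3)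
    · exact hL2 h3.symm h2 h1
    · exact hL2 h1 h2.symm h3.symm
    · exact h2.ne (congrArg _ (huniq h1 h3.symm))
    · exact hL2 h1.symm h3 h2
    · exact h3.ne (congrArg _ (huniq h2 h1.symm))
    · exact h1.ne (congrArg _ (huniq h3 h2.symm))
    · exact not_triangle_of_egirth hR (hrr h1) (hrr h2) (hrr h3)
  · rintro (p | p) (q | q) (v | v) (w | w) h1 h2 h3 h4 hpv hqw
    · exact not_square_of_egirth hL (hll h1) (hll h2) (hll h3) (hll h4)
        (fun h => hpv (congrArg _ (Subtype.ext h))) (fun h => hqw (congrArg _ (Subtype.ext h)))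
    · exact hpv (congrArg _ (huniq' h4.symm h3))
    · exact hqw (congrArg _ (huniq' h2 h3.symm))
    · exact hL2 h4.symm h2 h1
    · exact hpv (congrArg _ (huniq' h1 h2.symm))
    · exact hpv (congrArg _ (huniq' h1 h2.symm))
    · exact hL2 h1 h3.symm h4.symm
    · exact hqw (congrArg _ (huniq h1 h4.symm))
    · exact hqw (congrArg _ (huniq' h1.symm h4))
    · exact hL2 h1.symm h3 h2
    · exact hqw (congrArg _ (huniq' h2 h3.symm))
    · exact hpv (congrArg _ (huniq h1.symm h2))
    · exact hL2 h2.symm h4 h3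
    · exact hqw (congrArg _ (huniq h2.symm h3))
    · exact hpv (congrArg _ (huniq h4 h3.symm))
    · exact not_square_of_egirth hR (hrr h1) (hrr h2) (hrr h3) (hrr h4)
        (fun h => hpv (congrArg _ h)) (fun h => hqw (congrArg _ h))

open Classical in
theorem IsDotEdge.valency_induce [Finite V] (hD : IsDotEdge L x y r s t u)
    (v : ({x, y}ᶜ : Set V)) :
    valency (L.induce {x, y}ᶜ) v + (if (v : V) = r ∨ (v : V) = s ∨ (v : V) = t ∨ (v : V) = u
      then 1 else 0) = valency L v := by
  rw [← BoldGadget.valency_induce L {x, y}ᶜ v]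
  have hv : (v : V) ≠ x ∧ (v : V) ≠ y :=
    ⟨fun h => v.2 (Or.inl h), fun h => v.2 (Or.inr h)⟩
  have hl := hD.adj_left_iff
  have hr := hD.adj_right_iff
  obtain ⟨-, -, hrs, htu, hrt, hru, hst, hsu, -⟩ := hD
  have hmem : ∀ w, w ∈ {w | w ∉ ({x, y}ᶜ : Set V) ∧ L.Adj v w} ↔
      w = x ∧ ((v : V) = r ∨ (v : V) = s) ∨ w = y ∧ ((v : V) = t ∨ (v : V) = u) := by
    intro w
    have h1 := hl v
    have h2 := hr v
    simp only [Set.mem_ofPred_eq, Set.mem_compl_iff, Set.mem_insert_iff, Set.mem_singleton_iff,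
      not_not, adj_comm _ (v : V)]
    grind
  rw [ncard_eq_ite_of_subsingleton (S := {w | w ∉ ({x, y}ᶜ : Set V) ∧ L.Adj v w})]
  · congr 1
    refine if_congr ?_ rfl rfl
    unfold Set.Nonempty
    rw [exists_congr hmem]
    simp only [exists_or, exists_eq_left]
    tauto
  · intro w hw w' hw'
    rw [hmem] at hw hw'
    grind

open Classical in
theorem valency_deleteEdges_pair [Finite W] (hab : R.Adj a b) (hcd : R.Adj c d)
    (hi : a ≠ c ∧ a ≠ d ∧ b ≠ c ∧ b ≠ d) (w : W) :
    valency (R.deleteEdges {s(a, b), s(c, d)}) w + (if w = a ∨ w = b ∨ w = c ∨ w = d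
      then 1 else 0) = valency R w := by
  have h1 := hab.ne
  have h2 := hcd.ne
  have hle := deleteEdges_le (G := R) {s(a, b), s(c, d)}
  have hmem : ∀ z, z ∈ {z | R.Adj w z ∧ ¬ (R.deleteEdges {s(a, b), s(c, d)}).Adj w z} ↔
      w = a ∧ z = b ∨ w = b ∧ z = a ∨ w = c ∧ z = d ∨ w = d ∧ z = c := by
    intro z
    simp only [Set.mem_ofPred_eq, deleteEdges_adj, Set.mem_insert_iff, Set.mem_singleton_iff,
      Sym2.eq_iff]
    constructor
    · tauto
    · rintro (⟨rfl, rfl⟩ | ⟨rfl, rfl⟩ | ⟨rfl, rfl⟩ | ⟨rfl, rfl⟩)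
      · simp [hab]
      · simp [hab.symm]
      · simp [hcd]
      · simp [hcd.symm]
  have hsplit : valency R w = valency (R.deleteEdges {s(a, b), s(c, d)}) w +
      {z | R.Adj w z ∧ ¬ (R.deleteEdges {s(a, b), s(c, d)}).Adj w z}.ncard := by
    unfold valency
    rw [← Set.ncard_union_eq _ (Set.toFinite _) (Set.toFinite _)]
    · congr 1
      ext z
      have := @hle w z
      simp only [mem_neighborSet, Set.mem_union, Set.mem_ofPred_eq]
      tauto
    · rw [Set.disjoint_left]
      exact fun z hz hz' => hz'.2 hz
  rw [hsplit, ncard_eq_ite_of_subsingleton]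
  · congr 1
    refine if_congr ?_ rfl rfl
    unfold Set.Nonempty
    rw [exists_congr hmem]
    simp only [exists_or, exists_and_left, exists_eq, and_true]
  · intro z hz z' hz'
    rw [hmem] at hz hz'
    grind

theorem IsDotEdge.mem_compl (hD : IsDotEdge L x y r s t u) {v : V}
    (hv : v = r ∨ v = s ∨ v = t ∨ v = u) : v ∈ ({x, y}ᶜ : Set V) := by
  have h1 := hD.adj_xr.ne
  have h2 := hD.adj_xs.ne
  have h3 := hD.adj_yt.ne
  have h4 := hD.adj_yu.ne
  have h5 := hD.ne_yr
  have h6 := hD.ne_ys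
  have h7 := hD.ne_xt
  have h8 := hD.ne_xu
  simp only [Set.mem_compl_iff, Set.mem_insert_iff, Set.mem_singleton_iff]
  grind

theorem valency_dotProduct [Finite V] [Finite W] (hL : ∀ v, valency L v = 3)
    (hR : ∀ v, valency R v = 3) (hD : IsDotEdge L x y r s t u) (hab : R.Adj a b) (hcd : R.Adj c d)
    (hi : a ≠ c ∧ a ≠ d ∧ b ≠ c ∧ b ≠ d) (z) :
    valency (dotProduct L x y r s t u R a b c d) z = 3 := by
  classical
  have hab' := hab.ne
  have hcd' := hcd.ne
  rcases z with v | w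
  · have hcomap : (dotProduct L x y r s t u R a b c d).comap Sum.inl = L.induce {x, y}ᶜ := by
      ext p q
      exact dotProduct_adj_inl_inl
    rw [valency_inl, hcomap, ← hL v, ← hD.valency_induce v, ncard_eq_ite_of_subsingleton]
    · congr 1
      refine if_congr ?_ rfl rfl
      unfold Set.Nonempty
      simp only [Set.mem_ofPred_eq, dotProduct_adj_inl_inr, exists_or, exists_and_left, exists_eq,
        and_true]
    · intro w hw w' hw'
      rw [Set.mem_ofPred_eq, dotProduct_adj_inl_inr] at hw hw'
      obtain ⟨-, -, hrs, htu, hrt, hru, hst, hsu, -⟩ := hD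
      grind
  · have hcomap : (dotProduct L x y r s t u R a b c d).comap Sum.inr =
        R.deleteEdges {s(a, b), s(c, d)} := by
      ext p q
      exact dotProduct_adj_inr_inr
    rw [valency_inr, hcomap, ← hR w, ← valency_deleteEdges_pair hab hcd hi w,
      ncard_eq_ite_of_subsingleton]
    · congr 1
      refine if_congr ?_ rfl rfl
      unfold Set.Nonempty
      simp only [Set.mem_ofPred_eq, dotProduct_adj_inl_inr]
      constructor
      · rintro ⟨v, hv⟩
        tauto
      · rintro (rfl | rfl | rfl | rfl)
        exacts [⟨⟨r, hD.mem_compl (by simp)⟩, by simp⟩, ⟨⟨s, hD.mem_compl (by simp)⟩, by simp⟩,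
          ⟨⟨t, hD.mem_compl (by simp)⟩, by simp⟩, ⟨⟨u, hD.mem_compl (by simp)⟩, by simp⟩]
    · intro v hv v' hv'
      rw [Set.mem_ofPred_eq, dotProduct_adj_inl_inr] at hv hv'
      apply Subtype.ext
      grind

end

end BoldGadget

/-! ### Cuts in the two halves -/

namespace BoldGadget

open SimpleGraph

variable {V W : Type*}

open Classical in
/-- The indicator of `v ∈ A`. -/
noncomputable def ind (A : Set V) (v : V) : ℕ := if v ∈ A then 1 else 0

theorem ind_le_one (A : Set V) (v : V) : ind A v ≤ 1 := by
  unfold ind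
  split_ifs <;> omega

section

variable {L : SimpleGraph V} {R : SimpleGraph W} {x y r s t u : V} {a b c d : W}

theorem ind_sum_le_ncard [Finite V] (hrs : r ≠ s) (htu : t ≠ u) (hrt : r ≠ t) (hru : r ≠ u)
    (hst : s ≠ t) (hsu : s ≠ u) (A : Set V) :
    ind A r + ind A s + ind A t + ind A u = (A ∩ {r, s, t, u}).ncard := by
  classical
  have : A ∩ {r, s, t, u} = (({r, s, t, u} : Finset V).filter (· ∈ A) : Finset V) := by
    ext v
    simp [and_comm]
  rw [this, Set.ncard_coe_finset, Finset.card_filter, Finset.sum_insert (by simp [hrs, hrt, hru]),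
    Finset.sum_insert (by simp [hst, hsu]), Finset.sum_pair htu]
  unfold ind
  ring

theorem ncard_le_of_four (p : V × V → Prop) (S : Set (V × V)) (z₁ z₂ z₃ z₄ : V × V)
    (h : ∀ z ∈ S, p z ∧ (z = z₁ ∨ z = z₂ ∨ z = z₃ ∨ z = z₄)) [DecidablePred p] :
    S.ncard ≤ (if p z₁ then 1 else 0) + (if p z₂ then 1 else 0) + (if p z₃ then 1 else 0) +
      (if p z₄ then 1 else 0) := by
  classical
  have hsub : S ⊆ ((if p z₁ then {z₁} else ∅) ∪ (if p z₂ then {z₂} else ∅) ∪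
      (if p z₃ then {z₃} else ∅) ∪ (if p z₄ then {z₄} else ∅) : Finset (V × V)) := by
    intro z hz
    obtain ⟨hp, rfl | rfl | rfl | rfl⟩ := h z hz <;> simp [hp]
  refine (Set.ncard_le_ncard hsub (Finset.finite_toSet _)).trans ?_
  rw [Set.ncard_coe_finset]
  have hc : ∀ z, (if p z then {z} else ∅ : Finset (V × V)).card = if p z then 1 else 0 := by
    intro z
    split_ifs <;> simp
  rw [← hc z₁, ← hc z₂, ← hc z₃, ← hc z₄]
  refine (Finset.card_union_le _ _).trans (Nat.add_le_add_right ?_ _)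
  refine (Finset.card_union_le _ _).trans (Nat.add_le_add_right ?_ _)
  exact Finset.card_union_le _ _

/-- Restoring `x` and `y` outside of `A`. -/
theorem IsDotEdge.cutSize_image_le [Finite V] (hD : IsDotEdge L x y r s t u)
    (A : Set ({x, y}ᶜ : Set V)) :
    cutSize L (Subtype.val '' A) ≤ cutSize (L.induce {x, y}ᶜ) A +
      (ind (Subtype.val '' A) r + ind (Subtype.val '' A) s + ind (Subtype.val '' A) t +
        ind (Subtype.val '' A) u) := by
  classical
  set B : Set V := Subtype.val '' A with hB
  have hsub : {z : V × V | z.1 ∈ B ∧ z.2 ∉ B ∧ L.Adj z.1 z.2} ⊆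
      (Prod.map Subtype.val Subtype.val '' {z : ({x, y}ᶜ : Set V) × ({x, y}ᶜ : Set V) |
        z.1 ∈ A ∧ z.2 ∉ A ∧ (L.induce {x, y}ᶜ).Adj z.1 z.2}) ∪
      {z | z.1 ∈ B ∧ (z = (r, x) ∨ z = (s, x) ∨ z = (t, y) ∨ z = (u, y))} := by
    rintro ⟨v, w⟩ ⟨hv, hw, hvw⟩
    by_cases hwx : w ∈ ({x, y}ᶜ : Set V)
    · obtain ⟨v, hv', rfl⟩ := hv
      exact Or.inl ⟨(v, ⟨w, hwx⟩), ⟨hv', fun h => hw ⟨_, h, rfl⟩, hvw⟩, rfl⟩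
    · refine Or.inr ⟨hv, ?_⟩
      obtain ⟨v, hv', rfl⟩ := hv
      have h1 : (v : V) ≠ x := fun h => v.2 (Or.inl h)
      have h2 : (v : V) ≠ y := fun h => v.2 (Or.inr h)
      simp only [Set.mem_compl_iff, not_not] at hwx
      rcases hwx with rfl | rfl
      · have := (hD.adj_left_iff v).1 hvw.symm
        simp only [Prod.mk.injEq]
        tauto
      · have := (hD.adj_right_iff v).1 hvw.symm
        simp only [Prod.mk.injEq]
        tauto
  refine (Set.ncard_le_ncard hsub (Set.toFinite _)).trans ((Set.ncard_union_le _ _).trans ?_)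
  rw [Set.ncard_image_of_injective _
    (Subtype.val_injective.prodMap Subtype.val_injective)]
  refine Nat.add_le_add_left ?_ _
  exact ncard_le_of_four (fun z => z.1 ∈ B) _ (r, x) (s, x) (t, y) (u, y) fun z hz => hz

open Classical in
theorem cutSize_le_deleteEdges_pair [Finite W] (A : Set W) :
    cutSize R A ≤ cutSize (R.deleteEdges {s(a, b), s(c, d)}) A +
      ((if (a ∈ A ↔ b ∉ A) then 1 else 0) + (if (c ∈ A ↔ d ∉ A) then 1 else 0)) := by
  have hsub : {z : W × W | z.1 ∈ A ∧ z.2 ∉ A ∧ R.Adj z.1 z.2} ⊆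
      {z : W × W | z.1 ∈ A ∧ z.2 ∉ A ∧ (R.deleteEdges {s(a, b), s(c, d)}).Adj z.1 z.2} ∪
      {z | (z.1 ∈ A ∧ z.2 ∉ A) ∧ (z = (a, b) ∨ z = (b, a) ∨ z = (c, d) ∨ z = (d, c))} := by
    rintro ⟨v, w⟩ ⟨hv, hw, hvw⟩
    by_cases h : s(v, w) ∈ ({s(a, b), s(c, d)} : Set (Sym2 W))
    · refine Or.inr ⟨⟨hv, hw⟩, ?_⟩
      simp only [Set.mem_insert_iff, Set.mem_singleton_iff, Sym2.eq_iff] at h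
      simp only [Prod.mk.injEq]
      tauto
    · exact Or.inl ⟨hv, hw, deleteEdges_adj.2 ⟨hvw, h⟩⟩
  refine (Set.ncard_le_ncard hsub (Set.toFinite _)).trans ((Set.ncard_union_le _ _).trans ?_)
  refine Nat.add_le_add_left ((ncard_le_of_four (fun z => z.1 ∈ A ∧ z.2 ∉ A) _ (a, b) (b, a)
    (c, d) (d, c) fun z hz => hz).trans ?_) _
  by_cases h1 : a ∈ A <;> by_cases h2 : b ∈ A <;> by_cases h3 : c ∈ A <;> by_cases h4 : d ∈ A <;>
    simp [h1, h2, h3, h4]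

/-- Up to complement, `A` contains at most two of `r, s, t, u`. With `x` and `y` put on the other
side, the cut in `L` is at least four and loses at most two edges; for a single vertex it is at
least three and loses at most one. -/
theorem IsDotEdge.two_le_cutSize [Finite V] (hL : HasOnlyTrivialThreeCuts L)
    (h3 : ∀ v, valency L v = 3) (hD : IsDotEdge L x y r s t u) {A : Set ({x, y}ᶜ : Set V)}
    (hA : A.Nonempty) (hA' : Aᶜ.Nonempty) : 2 ≤ cutSize (L.induce {x, y}ᶜ) A := by
  have key : ∀ A : Set ({x, y}ᶜ : Set V), A.Nonempty →
      ind (Subtype.val '' A) r + ind (Subtype.val '' A) s + ind (Subtype.val '' A) t +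
        ind (Subtype.val '' A) u ≤ 2 → 2 ≤ cutSize (L.induce {x, y}ᶜ) A := by
    intro A hA hle
    have h1 := hD.cutSize_image_le A
    set B : Set V := Subtype.val '' A with hB
    have hBx : {x, y} ⊆ Bᶜ := by
      rintro v hv ⟨w, -, rfl⟩
      exact w.2 hv
    have h2 := Set.ncard_le_ncard hBx (Set.toFinite _)
    rw [Set.ncard_pair hD.adj.ne] at h2
    have hne : B.Nonempty := hA.image _
    have hpos := (Set.ncard_pos (Set.toFinite _)).2 hne
    by_cases hB1 : B.ncard = 1
    · have h4 := hL.three_le h3 hne ⟨x, hBx (by simp)⟩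
      have h5 := ind_sum_le_ncard hD.ne_rs hD.ne_tu hD.ne_rt hD.ne_ru hD.ne_st hD.ne_su B
      have h6 := Set.ncard_le_ncard (Set.inter_subset_left (s := B) (t := {r, s, t, u}))
        (Set.toFinite _)
      omega
    · have := hL B (by omega) h2
      omega
  by_cases h : ind (Subtype.val '' A) r + ind (Subtype.val '' A) s + ind (Subtype.val '' A) t +
        ind (Subtype.val '' A) u ≤ 2
  · exact key A hA h
  · rw [← cutSize_compl]
    refine key _ hA' ?_
    have hc : ∀ v, v = r ∨ v = s ∨ v = t ∨ v = u →
        ind (Subtype.val '' Aᶜ) v = 1 - ind (Subtype.val '' A) v := by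
      intro v hv
      have hv' := hD.mem_compl hv
      have hmem : ∀ B : Set ({x, y}ᶜ : Set V), v ∈ (Subtype.val '' B : Set V) ↔ ⟨v, hv'⟩ ∈ B :=
        fun B => ⟨by rintro ⟨w, hw, rfl⟩; exact hw, fun h => ⟨_, h, rfl⟩⟩
      unfold ind
      rw [hmem, hmem]
      by_cases hvA : (⟨v, hv'⟩ : ({x, y}ᶜ : Set V)) ∈ A <;> simp [hvA]
    have := ind_le_one (Subtype.val '' A) r
    have := ind_le_one (Subtype.val '' A) s
    have := ind_le_one (Subtype.val '' A) t
    have := ind_le_one (Subtype.val '' A) u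
    rw [hc r (by simp), hc s (by simp), hc t (by simp), hc u (by simp)]
    omega

/-- A cut of at least four loses at most two edges. A single vertex has cut at least three and loses
at most one, because `ab` and `cd` are independent. -/
theorem two_le_cutSize_deleteEdges_pair [Finite W] (hR : HasOnlyTrivialThreeCuts R)
    (h3 : ∀ v, valency R v = 3) (hi : a ≠ c ∧ a ≠ d ∧ b ≠ c ∧ b ≠ d) {A : Set W}
    (hA : A.Nonempty) (hA' : Aᶜ.Nonempty) :
    2 ≤ cutSize (R.deleteEdges {s(a, b), s(c, d)}) A := by
  classical
  have key : ∀ A : Set W, A.ncard = 1 → Aᶜ.Nonempty →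
      2 ≤ cutSize (R.deleteEdges {s(a, b), s(c, d)}) A := by
    intro A hA hA'
    obtain ⟨v, rfl⟩ := Set.ncard_eq_one.1 hA
    have h1 := hR.three_le h3 (A := {v}) (by simp) hA'
    have h2 := cutSize_le_deleteEdges_pair (R := R) (a := a) (b := b) (c := c) (d := d) {v}
    simp only [Set.mem_singleton_iff] at h2
    split_ifs at h2 with h4 h5 h5 <;> grind
  have h1 := (Set.ncard_pos (Set.toFinite _)).2 hA
  have h2 := (Set.ncard_pos (Set.toFinite _)).2 hA'
  by_cases hA1 : A.ncard = 1
  · exact key A hA1 hA'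
  by_cases hA2 : Aᶜ.ncard = 1
  · rw [← cutSize_compl]
    exact key _ hA2 (by rwa [compl_compl])
  have h4 := hR A (by omega) (by omega)
  have h5 := cutSize_le_deleteEdges_pair (R := R) (a := a) (b := b) (c := c) (d := d) A
  split_ifs at h5 <;> omega

end

end BoldGadget

/-! ### Cuts in the dot product -/

namespace BoldGadget

open SimpleGraph

variable {V W : Type*} [Finite V] [Finite W] {L : SimpleGraph V} {R : SimpleGraph W}
  {x y r s t u : V} {a b c d : W}

open Classical in
theorem IsDotEdge.le_cutSize_dotProduct (hD : IsDotEdge L x y r s t u)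
    (A : Set (({x, y}ᶜ : Set V) ⊕ W)) :
    cutSize (L.induce {x, y}ᶜ) (Sum.inl ⁻¹' A) +
      cutSize (R.deleteEdges {s(a, b), s(c, d)}) (Sum.inr ⁻¹' A) +
      ((if r ∈ (Subtype.val '' (Sum.inl ⁻¹' A : Set ({x, y}ᶜ : Set V)) : Set V) ↔ Sum.inr a ∉ A
        then 1 else 0) +
      (if s ∈ (Subtype.val '' (Sum.inl ⁻¹' A : Set ({x, y}ᶜ : Set V)) : Set V) ↔ Sum.inr b ∉ A
        then 1 else 0) +
      (if t ∈ (Subtype.val '' (Sum.inl ⁻¹' A : Set ({x, y}ᶜ : Set V)) : Set V) ↔ Sum.inr c ∉ A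
        then 1 else 0) +
      (if u ∈ (Subtype.val '' (Sum.inl ⁻¹' A : Set ({x, y}ᶜ : Set V)) : Set V) ↔ Sum.inr d ∉ A
        then 1 else 0)) ≤ cutSize (dotProduct L x y r s t u R a b c d) A := by
  have hmem : ∀ (v : V) (hv : v ∈ ({x, y}ᶜ : Set V)),
      v ∈ (Subtype.val '' (Sum.inl ⁻¹' A : Set ({x, y}ᶜ : Set V)) : Set V) ↔
        Sum.inl ⟨v, hv⟩ ∈ A :=
    fun v hv => ⟨by rintro ⟨w, hw, rfl⟩; exact hw, fun h => ⟨_, h, rfl⟩⟩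
  have hr := hD.mem_compl (v := r) (by simp)
  have hs := hD.mem_compl (v := s) (by simp)
  have ht := hD.mem_compl (v := t) (by simp)
  have hu := hD.mem_compl (v := u) (by simp)
  rw [hmem r hr, hmem s hs, hmem t ht, hmem u hu]
  set J : Finset (({x, y}ᶜ : Set V) × W) :=
    ({(⟨r, hr⟩, a), (⟨s, hs⟩, b), (⟨t, ht⟩, c), (⟨u, hu⟩, d)} : Finset _).filter
      (fun p => Sum.inl p.1 ∈ A ↔ Sum.inr p.2 ∉ A) with hJ
  have hJcard : (J : Set (({x, y}ᶜ : Set V) × W)).ncard =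
      (if Sum.inl ⟨r, hr⟩ ∈ A ↔ Sum.inr a ∉ A then 1 else 0) +
      (if Sum.inl ⟨s, hs⟩ ∈ A ↔ Sum.inr b ∉ A then 1 else 0) +
      (if Sum.inl ⟨t, ht⟩ ∈ A ↔ Sum.inr c ∉ A then 1 else 0) +
      (if Sum.inl ⟨u, hu⟩ ∈ A ↔ Sum.inr d ∉ A then 1 else 0) := by
    rw [Set.ncard_coe_finset, hJ, Finset.card_filter,
      Finset.sum_insert (by simp [hD.ne_rs, hD.ne_rt, hD.ne_ru]),
      Finset.sum_insert (by simp [hD.ne_st, hD.ne_su]), Finset.sum_pair (by simp [hD.ne_tu])]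
    ring
  rw [← hJcard]
  -- Orients a crossing joining edge from `A` to its complement, as `cutSize` counts it.
  let φ : ({x, y}ᶜ : Set V) × W → (({x, y}ᶜ : Set V) ⊕ W) × (({x, y}ᶜ : Set V) ⊕ W) := fun p =>
    if Sum.inl p.1 ∈ A then (Sum.inl p.1, Sum.inr p.2) else (Sum.inr p.2, Sum.inl p.1)
  have hφ : Function.Injective φ := by
    rintro ⟨p, q⟩ ⟨p', q'⟩ h
    simp only [φ] at h
    split_ifs at h <;> simp_all
  have hl : Function.Injective (Prod.map Sum.inl Sum.inl :
      ({x, y}ᶜ : Set V) × ({x, y}ᶜ : Set V) →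
        (({x, y}ᶜ : Set V) ⊕ W) × (({x, y}ᶜ : Set V) ⊕ W)) :=
    Sum.inl_injective.prodMap Sum.inl_injective
  have hr' : Function.Injective (Prod.map Sum.inr Sum.inr :
      W × W → (({x, y}ᶜ : Set V) ⊕ W) × (({x, y}ᶜ : Set V) ⊕ W)) :=
    Sum.inr_injective.prodMap Sum.inr_injective
  unfold cutSize
  rw [← Set.ncard_image_of_injective _ hφ, ← Set.ncard_image_of_injective _ hl,
    ← Set.ncard_image_of_injective _ hr', ← Set.ncard_union_eq _ (Set.toFinite _) (Set.toFinite _),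
    ← Set.ncard_union_eq _ (Set.toFinite _) (Set.toFinite _)]
  · refine Set.ncard_le_ncard ?_ (Set.toFinite _)
    rintro _ ((⟨⟨v, w⟩, ⟨h1, h2, h3⟩, rfl⟩ | ⟨⟨v, w⟩, ⟨h1, h2, h3⟩, rfl⟩) | ⟨⟨v, w⟩, h, rfl⟩)
    · exact ⟨h1, h2, dotProduct_adj_inl_inl.2 h3⟩
    · exact ⟨h1, h2, dotProduct_adj_inr_inr.2 h3⟩
    · simp only [hJ, Finset.coe_filter, Set.mem_ofPred_eq, Finset.mem_insert,
        Finset.mem_singleton, Prod.mk.injEq] at h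
      have hadj : (dotProduct L x y r s t u R a b c d).Adj (Sum.inl v) (Sum.inr w) := by
        rw [dotProduct_adj_inl_inr]
        rcases h.1 with h | h | h | h <;> simp [h.1, h.2]
      simp only [φ]
      split_ifs with hv
      · exact ⟨hv, h.2.1 hv, hadj⟩
      · exact ⟨by simpa [hv] using h.2, hv, hadj.symm⟩
  · rw [Set.disjoint_left]
    rintro _ (⟨⟨v, w⟩, -, rfl⟩ | ⟨⟨v, w⟩, -, rfl⟩) ⟨⟨v', w'⟩, -, h⟩ <;>
    · simp only [φ] at h
      split_ifs at h <;> simp at h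
  · rw [Set.disjoint_left]
    rintro _ ⟨⟨v, w⟩, -, rfl⟩ ⟨⟨v', w'⟩, -, h⟩
    simp at h

theorem ncard_eq_preimage_add (A : Set (V ⊕ W)) :
    A.ncard = (Sum.inl ⁻¹' A).ncard + (Sum.inr ⁻¹' A).ncard := by
  rw [← Set.ncard_image_of_injective (Sum.inl ⁻¹' A) (Sum.inl_injective (β := W)),
    ← Set.ncard_image_of_injective (Sum.inr ⁻¹' A) (Sum.inr_injective (α := V)),
    ← Set.ncard_union_eq _ (Set.toFinite _) (Set.toFinite _)]
  · congr 1
    ext (v | v) <;> simp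
  · rw [Set.disjoint_left]
    rintro _ ⟨v, -, rfl⟩ ⟨w, -, h⟩
    cases h

/-- If `A` splits both halves, each contributes two edges. If `A` lies in the half of `L`, joining
edges stand in for the lost edges to `x` and `y`, so the bound in `L` carries over. If `A` lies
properly in the half of `R`, there are two cases: with at most two of `a, b, c, d` in `A`, the cut
in `R` is at least four and each separated gadget edge is compensated by a joining edge; with at
least three, these joining edges and two edges inside `R` suffice. Complements cover the rest. -/
theorem hasOnlyTrivialThreeCuts_dotProduct (hL : HasOnlyTrivialThreeCuts L)
    (hR : HasOnlyTrivialThreeCuts R) (hL3 : ∀ v, valency L v = 3) (hR3 : ∀ v, valency R v = 3)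
    (hD : IsDotEdge L x y r s t u) (hab : a ≠ b) (hcd : c ≠ d)
    (hi : a ≠ c ∧ a ≠ d ∧ b ≠ c ∧ b ≠ d) :
    HasOnlyTrivialThreeCuts (dotProduct L x y r s t u R a b c d) := by
  classical
  have hright : ∀ A : Set (({x, y}ᶜ : Set V) ⊕ W), 2 ≤ A.ncard → 2 ≤ Aᶜ.ncard →
      (Sum.inr ⁻¹' A : Set W) = ∅ → 4 ≤ cutSize (dotProduct L x y r s t u R a b c d) A := by
    intro A hA hA' h0
    have h1 := hD.le_cutSize_dotProduct (R := R) (a := a) (b := b) (c := c) (d := d) A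
    have h2 := hD.cutSize_image_le (Sum.inl ⁻¹' A)
    have h3 := ncard_eq_preimage_add A
    have hn : ∀ w, Sum.inr w ∉ A := fun w hw => (Set.ext_iff.1 h0 w).1 hw
    rw [h0, Set.ncard_empty, add_zero,
      ← Set.ncard_image_of_injective _ (Subtype.val_injective (p := (· ∈ ({x, y}ᶜ : Set V))))] at h3
    have hBx : {x, y} ⊆ (Subtype.val '' (Sum.inl ⁻¹' A : Set ({x, y}ᶜ : Set V)) : Set V)ᶜ := by
      rintro v hv ⟨w, -, rfl⟩
      exact w.2 hv
    have h4 := Set.ncard_le_ncard hBx (Set.toFinite _)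
    rw [Set.ncard_pair hD.adj.ne] at h4
    have h5 := hL (Subtype.val '' (Sum.inl ⁻¹' A)) (by omega) h4
    simp only [hn, not_false_iff, iff_true] at h1
    unfold ind at h2
    omega
  have hleft : ∀ A : Set (({x, y}ᶜ : Set V) ⊕ W), 2 ≤ A.ncard → 2 ≤ Aᶜ.ncard →
      (Sum.inl ⁻¹' A : Set ({x, y}ᶜ : Set V)) = ∅ → (Sum.inr ⁻¹' A : Set W).Nonempty →
      (Sum.inr ⁻¹' A : Set W)ᶜ.Nonempty →
      4 ≤ cutSize (dotProduct L x y r s t u R a b c d) A := by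
    intro A hA hA' h0 hne hne'
    have h1 := hD.le_cutSize_dotProduct (R := R) (a := a) (b := b) (c := c) (d := d) A
    have h2 := cutSize_le_deleteEdges_pair (R := R) (a := a) (b := b) (c := c) (d := d)
      (Sum.inr ⁻¹' A)
    have h3 := ncard_eq_preimage_add A
    have h4 := two_le_cutSize_deleteEdges_pair hR hR3 hi hne hne'
    rw [h0, Set.ncard_empty, zero_add] at h3
    have h5 : ∀ p q : W, p ≠ q → p ∈ (Sum.inr ⁻¹' A : Set W)ᶜ → q ∈ (Sum.inr ⁻¹' A : Set W)ᶜ →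
        4 ≤ cutSize R (Sum.inr ⁻¹' A) := by
      intro p q hpq hp hq
      refine hR _ (by omega) ?_
      rw [← Set.ncard_pair hpq]
      refine Set.ncard_le_ncard ?_ (Set.toFinite _)
      rintro v (rfl | rfl)
      exacts [hp, hq]
    simp only [h0, Set.image_empty, Set.mem_empty_iff_false, false_iff, not_not] at h1
    have h6 := h5 a b hab
    have h7 := h5 c d hcd
    have h8 := h5 a c hi.1
    have h9 := h5 a d hi.2.1
    have h10 := h5 b c hi.2.2.1
    have h11 := h5 b d hi.2.2.2
    simp only [Set.mem_compl_iff, Set.mem_preimage] at *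
    by_cases ha : Sum.inr a ∈ A <;> by_cases hb : Sum.inr b ∈ A <;>
      by_cases hc : Sum.inr c ∈ A <;> by_cases hd : Sum.inr d ∈ A <;>
      simp only [ha, hb, hc, hd, not_true, not_false_iff, if_true, if_false, iff_true, iff_false,
        forall_const, IsEmpty.forall_iff] at * <;> omega
  intro A hA hA'
  by_cases h1 : (Sum.inr ⁻¹' A : Set W) = ∅
  · exact hright A hA hA' h1
  by_cases h2 : (Sum.inr ⁻¹' A : Set W)ᶜ = ∅
  · rw [← cutSize_compl]
    exact hright _ hA' (by rwa [compl_compl]) (by rwa [Set.preimage_compl])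
  have h1' := Set.nonempty_iff_ne_empty.2 h1
  have h2' := Set.nonempty_iff_ne_empty.2 h2
  by_cases h3 : (Sum.inl ⁻¹' A : Set ({x, y}ᶜ : Set V)) = ∅
  · exact hleft A hA hA' h3 h1' h2'
  by_cases h4 : (Sum.inl ⁻¹' A : Set ({x, y}ᶜ : Set V))ᶜ = ∅
  · rw [← cutSize_compl]
    exact hleft _ hA' (by rwa [compl_compl]) (by rwa [Set.preimage_compl])
      (by rwa [Set.preimage_compl]) (by rwa [Set.preimage_compl, compl_compl])
  have h5 := hD.le_cutSize_dotProduct (R := R) (a := a) (b := b) (c := c) (d := d) A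
  have h6 := hD.two_le_cutSize hL hL3 (Set.nonempty_iff_ne_empty.2 h3)
    (Set.nonempty_iff_ne_empty.2 h4)
  have h7 := two_le_cutSize_deleteEdges_pair hR hR3 hi h1' h2'
  omega

end BoldGadget

/-! ### The edge chromatic number -/

namespace BoldGadget

open SimpleGraph

variable {V W E : Type*}

theorem exists_notMem_image_of_ncard_le [Finite E] (c : E → Fin 4) {S : Set E} (hS : S.ncard ≤ 3) :
    ∃ k, k ∉ c '' S := by
  by_contra! h
  have h1 : c '' S = Set.univ := Set.eq_univ_of_forall h
  have h2 := Set.ncard_image_le (f := c) (Set.toFinite S)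
  rw [h1, Set.ncard_univ, Nat.card_eq_fintype_card, Fintype.card_fin] at h2
  omega

/-- The greedy proof of Brooks' theorem: `e₁` and `e₂` get the same colour, every other vertex is
coloured while it still has an uncoloured neighbour, and `e` comes last, with two of its at most
four neighbours coloured alike. The hypothesis `hconn` says that `H` stays connected without `e₁`
and `e₂`. -/
theorem colorable_four_of_connected [Finite E] {H : SimpleGraph E} (hdeg : ∀ v, valency H v ≤ 4)
    {e e₁ e₂ : E} (h1 : H.Adj e e₁) (h2 : H.Adj e e₂) (h12 : ¬ H.Adj e₁ e₂) (hne : e₁ ≠ e₂)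
    (hconn : ∀ U : Set E, e ∈ U → e₁ ∉ U → e₂ ∉ U → (∃ f, f ∉ U ∧ f ≠ e₁ ∧ f ≠ e₂) →
      ∃ f g, f ∉ U ∧ f ≠ e₁ ∧ f ≠ e₂ ∧ g ∈ U ∧ H.Adj f g) : H.Colorable 4 := by
  classical
  -- `U` is the set of vertices not yet coloured. In the induction step `f` is the last one
  -- coloured, and its neighbour `g` in `U` leaves at most three colours forbidden.
  have key : ∀ (n : ℕ) (U : Set E), Uᶜ.ncard = n → e ∈ U → e₁ ∉ U → e₂ ∉ U →
      ∃ c : E → Fin 4, c e₁ = 0 ∧ c e₂ = 0 ∧ ∀ f g, f ∉ U → g ∉ U → H.Adj f g → c f ≠ c g := by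
    intro n
    induction n with
    | zero =>
      intro U hU _ he1 _
      rw [Set.ncard_eq_zero (Set.toFinite _)] at hU
      exact ((Set.ext_iff.1 hU e₁).1 he1).elim
    | succ n ih =>
      intro U hU he he1 he2
      by_cases hex : ∃ f, f ∉ U ∧ f ≠ e₁ ∧ f ≠ e₂
      · obtain ⟨f, g, hf, hf1, hf2, hg, hfg⟩ := hconn U he he1 he2 hex
        obtain ⟨c, hc1, hc2, hc⟩ := ih (insert f U) (by
          have : (insert f U)ᶜ = Uᶜ \ {f} := by
            ext z
            simp only [Set.mem_compl_iff, Set.mem_insert_iff, Set.mem_sdiff,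
              Set.mem_singleton_iff]
            tauto
          rw [this, Set.ncard_sdiff_singleton_of_mem (show f ∈ Uᶜ from hf), hU]
          rfl) (Or.inr he) (by simp [hf1.symm, he1]) (by simp [hf2.symm, he2])
        obtain ⟨k, hk⟩ := exists_notMem_image_of_ncard_le c (S := H.neighborSet f \ {g}) (by
          have := Set.ncard_sdiff_singleton_of_mem (show g ∈ H.neighborSet f from hfg)
          have := hdeg f
          unfold valency at this
          omega)
        have hk' : ∀ z, z ∉ U → H.Adj f z → c z ≠ k := fun z hz hfz h =>
          hk ⟨z, ⟨hfz, fun hzg => hz (by rwa [Set.mem_singleton_iff.1 hzg])⟩, h⟩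
        refine ⟨Function.update c f k, by simp [hf1.symm, hc1], by simp [hf2.symm, hc2],
          fun p q hp hq hpq => ?_⟩
        by_cases hpf : p = f
        · subst hpf
          simpa [hpq.ne'] using (hk' q hq hpq).symm
        by_cases hqf : q = f
        · subst hqf
          simpa [hpf] using hk' p hp hpq.symm
        · simpa [hpf, hqf] using hc p q (by simp [hpf, hp]) (by simp [hqf, hq]) hpq
      · push Not at hex
        refine ⟨fun _ => 0, rfl, rfl, fun f g hf hg hfg => ?_⟩
        have hf' : f = e₁ ∨ f = e₂ := or_iff_not_imp_left.2 (hex f hf)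
        have hg' : g = e₁ ∨ g = e₂ := or_iff_not_imp_left.2 (hex g hg)
        rcases hf' with rfl | rfl <;> rcases hg' with rfl | rfl
        exacts [(hfg.ne rfl).elim, (h12 hfg).elim, (h12 hfg.symm).elim, (hfg.ne rfl).elim]
  obtain ⟨c, hc1, hc2, hc⟩ := key _ {e} rfl rfl h1.ne' h2.ne'
  obtain ⟨k, hk⟩ := exists_notMem_image_of_ncard_le c (S := H.neighborSet e \ {e₂}) (by
    have := Set.ncard_sdiff_singleton_of_mem (show e₂ ∈ H.neighborSet e from h2)
    have := hdeg e
    unfold valency at this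
    omega)
  have hk' : ∀ z, H.Adj e z → c z ≠ k := by
    intro z hz h
    by_cases hz2 : z = e₂
    · exact hk ⟨e₁, ⟨h1, hne⟩, by rw [← h, hz2, hc1, hc2]⟩
    · exact hk ⟨z, ⟨hz, hz2⟩, h⟩
  refine ⟨Coloring.mk (Function.update c e k) fun {p q} hpq => ?_⟩
  by_cases hpe : p = e
  · subst hpe
    simpa [hpq.ne'] using (hk' q hpq).symm
  by_cases hqe : q = e
  · subst hqe
    simpa [hpe] using hk' p hpq.symm
  · simpa [hpe, hqe] using hc p q hpe hqe hpq

theorem valency_lineGraph_le [Finite V] {G : SimpleGraph V} (h3 : ∀ v, valency G v = 3)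
    (e : G.edgeSet) : valency G.lineGraph e ≤ 4 := by
  obtain ⟨e, he⟩ := e
  induction e with
  | h p q =>
    have hpq : G.Adj p q := he
    unfold valency
    rw [← Set.ncard_image_of_injective _ Subtype.val_injective]
    have hsub : Subtype.val '' G.lineGraph.neighborSet ⟨s(p, q), he⟩ ⊆
        (fun z => s(p, z)) '' (G.neighborSet p \ {q}) ∪
          (fun z => s(q, z)) '' (G.neighborSet q \ {p}) := by
      rintro _ ⟨⟨f, hf⟩, hadj, rfl⟩
      rw [mem_neighborSet, lineGraph_adj_iff_exists] at hadj
      obtain ⟨hne, v, hv, hvf⟩ := hadj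
      obtain ⟨w, rfl⟩ := Sym2.mem_iff_exists.1 hvf
      rcases Sym2.mem_iff.1 hv with rfl | rfl
      · refine Or.inl ⟨w, ⟨hf, ?_⟩, rfl⟩
        rintro rfl
        exact hne rfl
      · refine Or.inr ⟨w, ⟨hf, ?_⟩, rfl⟩
        rintro rfl
        exact hne (Subtype.ext Sym2.eq_swap)
    refine (Set.ncard_le_ncard hsub (Set.toFinite _)).trans ((Set.ncard_union_le _ _).trans ?_)
    have h1 := Set.ncard_image_le (f := fun z => s(p, z)) (Set.toFinite (G.neighborSet p \ {q}))
    have h2 := Set.ncard_image_le (f := fun z => s(q, z)) (Set.toFinite (G.neighborSet q \ {p}))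
    have h3p := h3 p
    have h3q := h3 q
    rw [Set.ncard_sdiff_singleton_of_mem (show q ∈ G.neighborSet p from hpq)] at h1
    rw [Set.ncard_sdiff_singleton_of_mem (show p ∈ G.neighborSet q from hpq.symm)] at h2
    unfold valency at h3p h3q
    omega

/-- The three edges form a path `p' p q q'`, whose end edges are disjoint for lack of triangles. The
line graph stays connected without them because `G` has no cut of size at most two. -/
theorem colorable_four_lineGraph [Finite V] [Nonempty V] {G : SimpleGraph V}
    (h3 : ∀ v, valency G v = 3) (hG : HasOnlyTrivialThreeCuts G) (hg : 5 ≤ G.egirth) :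
    G.lineGraph.Colorable 4 := by
  have hex : ∀ p q, ∃ z, G.Adj p z ∧ z ≠ q := by
    intro p q
    have h := h3 p
    unfold valency at h
    obtain ⟨z, hz, hzq⟩ := Set.exists_ne_of_one_lt_ncard
      (by omega : 1 < (G.neighborSet p).ncard) q
    exact ⟨z, hz, hzq⟩
  obtain ⟨p⟩ := ‹Nonempty V›
  obtain ⟨q, hpq, -⟩ := hex p p
  obtain ⟨p', hpp', hp'q⟩ := hex p q
  obtain ⟨q', hqq', hq'p⟩ := hex q p
  have hp'q' : p' ≠ q' := by
    rintro rfl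
    exact not_triangle_of_egirth hg hpq hqq' hpp'.symm
  have hne := hpq.ne
  refine colorable_four_of_connected (valency_lineGraph_le h3) (e := ⟨s(p, q), hpq⟩)
    (e₁ := ⟨s(p, p'), hpp'⟩) (e₂ := ⟨s(q, q'), hqq'⟩) ?_ ?_ ?_ ?_ ?_
  · rw [lineGraph_adj_iff_exists]
    refine ⟨fun h => ?_, p, by simp, by simp⟩
    have h := Sym2.eq_iff.1 (congrArg Subtype.val h)
    grind
  · rw [lineGraph_adj_iff_exists]
    refine ⟨fun h => ?_, q, by simp, by simp⟩
    have h := Sym2.eq_iff.1 (congrArg Subtype.val h)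
    grind
  · rw [lineGraph_adj_iff_exists]
    rintro ⟨-, v, h1, h2⟩
    rw [Sym2.mem_iff] at h1 h2
    grind
  · intro h
    have h := Sym2.eq_iff.1 (congrArg Subtype.val h)
    grind
  · intro U he he1 he2 ⟨f, hfU, hf1, hf2⟩
    by_contra! hno
    have hno' : ∀ f g : G.edgeSet, f ∉ U → g ∈ U → ∀ v, v ∈ (f : Sym2 V) → v ∈ (g : Sym2 V) →
        f = ⟨s(p, p'), hpp'⟩ ∨ f = ⟨s(q, q'), hqq'⟩ := by
      intro f g hf hg v hvf hvg
      by_contra! h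
      refine hno f g hf h.1 h.2 hg (lineGraph_adj_iff_exists.2 ⟨?_, v, hvf, hvg⟩)
      rintro rfl
      exact hf hg
    -- If no edge outside `U`, other than the two end edges, touched `U`, then only these two could
    -- leave `A`.
    set A : Set V := {v | ∃ g ∈ U, v ∈ (g : Sym2 V)} with hA
    have hcut : cutSize G A ≤ ({s(p, p'), s(q, q')} : Set (Sym2 V)).ncard := by
      refine cutSize_le_ncard ?_
      rintro v ⟨g, hg, hv⟩ w hw hvw
      rcases hno' ⟨s(v, w), hvw⟩ g (fun h => hw ⟨_, h, by simp⟩) hg v (by simp) hv with h | h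
      · exact Or.inl (congrArg Subtype.val h)
      · exact Or.inr (congrArg Subtype.val h)
    have h2 := Set.ncard_insert_le s(p, p') {s(q, q')}
    rw [Set.ncard_singleton] at h2
    have h3' := hG.three_le h3 (A := A) ⟨p, _, he, by simp⟩ (by
      rw [Set.nonempty_iff_ne_empty]
      intro hemp
      rw [Set.compl_empty_iff] at hemp
      obtain ⟨v, hv⟩ : ∃ v, v ∈ (f : Sym2 V) := ⟨_, Sym2.out_fst_mem _⟩
      obtain ⟨g, hg, hvg⟩ : v ∈ A := hemp ▸ Set.mem_univ v
      rcases hno' f g hfU hg v hv hvg with h | h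
      exacts [hf1 h, hf2 h])
    omega

/-- Two colour classes form a 2-factor, and one of them is a perfect matching inside it, so its
components are even. -/
theorem not_colorable_three_lineGraph [Finite V] [Nonempty V] {G : SimpleGraph V}
    (h3 : ∀ v, valency G v = 3) (hG : IsOddTwoFactored G) : ¬ G.lineGraph.Colorable 3 := by
  classical
  rintro ⟨C⟩
  -- The default colour plays no role, as `col` is only used together with adjacency in `G`.
  let col : Sym2 V → Fin 3 := fun e => if h : e ∈ G.edgeSet then C ⟨e, h⟩ else 0
  have hcol : ∀ v w z, G.Adj v w → G.Adj v z → col s(v, w) = col s(v, z) → w = z := by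
    intro v w z hw hz h
    by_contra hne
    have hw' : s(v, w) ∈ G.edgeSet := hw
    have hz' : s(v, z) ∈ G.edgeSet := hz
    simp only [col, dif_pos hw', dif_pos hz'] at h
    refine C.valid (lineGraph_adj_iff_exists.2 ⟨fun he => ?_, v, by simp, by simp⟩) h
    have he := Sym2.eq_iff.1 (congrArg Subtype.val he)
    grind
  have hex : ∀ v k, ∃ w, G.Adj v w ∧ col s(v, w) = k := by
    intro v k
    have himg : ((fun w => col s(v, w)) '' G.neighborSet v).ncard = 3 := by
      rw [Set.InjOn.ncard_image (s := G.neighborSet v) fun w hw z hz h => hcol v w z hw hz h]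
      exact h3 v
    have huniv : (fun w => col s(v, w)) '' G.neighborSet v = Set.univ := by
      rw [Set.eq_univ_iff_ncard, himg, Nat.card_eq_fintype_card, Fintype.card_fin]
    obtain ⟨w, hw, h⟩ : k ∈ (fun w => col s(v, w)) '' G.neighborSet v := huniv ▸ Set.mem_univ k
    exact ⟨w, hw, h⟩
  let sub : (Fin 3 → Prop) → SimpleGraph V := fun p =>
    { Adj := fun v w => G.Adj v w ∧ p (col s(v, w))
      symm := ⟨fun v w h => ⟨h.1.symm, by rw [Sym2.eq_swap]; exact h.2⟩⟩
      loopless := ⟨fun v h => h.1.ne rfl⟩ }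
  have hF : IsTwoFactor G (sub (· ≠ 0)) := by
    refine ⟨fun v w h => h.1, fun v => ?_⟩
    obtain ⟨w, hw, hw0⟩ := hex v 0
    have : (sub (· ≠ 0)).neighborSet v = G.neighborSet v \ {w} := by
      ext z
      simp only [sub, mem_neighborSet, Set.mem_sdiff, Set.mem_singleton_iff]
      refine and_congr_right fun hz => not_congr ⟨fun h => ?_, ?_⟩
      · exact hcol v z w hz hw (h.trans hw0.symm)
      · rintro rfl
        exact hw0
    rw [this, Set.ncard_sdiff_singleton_of_mem (show w ∈ G.neighborSet v from hw)]
    have := h3 v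
    unfold valency at this
    omega
  have hM : ∀ v, valency (sub (· = 1)) v = 1 := by
    intro v
    obtain ⟨w, hw, hw1⟩ := hex v 1
    unfold valency
    rw [Set.ncard_eq_one]
    refine ⟨w, Set.eq_singleton_iff_unique_mem.2 ⟨⟨hw, hw1⟩, fun z hz => ?_⟩⟩
    exact hcol v z w hz.1 hw (hz.2.trans hw1.symm)
  obtain ⟨v⟩ := ‹Nonempty V›
  have h1 := (hG _ hF).allOdd (fun v => Or.inl (hF.2 v)) v
  have h2 := even_compCard_of_valency_eq_one (M := sub (· = 1)) (K := sub (· ≠ 0))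
    (fun v w h => ⟨h.1, by rw [h.2]; decide⟩) hM v
  exact (Nat.not_odd_iff_even.2 h2) h1

end BoldGadget

theorem theorem3p1 {V W : Type*} [Finite V] [Finite W]
    (L : SimpleGraph V) (R : SimpleGraph W)
    (hL : BoldGadget.IsSnark L) (hR : BoldGadget.IsSnark R)
    (x y r s t u : V) (a b c d : W)
    (hxy : BoldGadget.IsBoldEdge L x y)
    (hx : L.neighborSet x \ {y} = {r, s}) (hy : L.neighborSet y \ {x} = {t, u})
    (hg : BoldGadget.IsGadgetPair R a b c d) :
    BoldGadget.IsSnark (BoldGadget.dotProduct L x y r s t u R a b c d) ∧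
      BoldGadget.IsOddTwoFactored (BoldGadget.dotProduct L x y r s t u R a b c d) := by
  have hD := hL.isDotEdge hxy.adj hx hy
  have hab := hg.adj_left.ne
  have hcd := hg.adj_right.ne
  have hi := hg.independent
  have hodd := BoldGadget.isOddTwoFactored_dotProduct hxy hD hg
  have h3 := BoldGadget.valency_dotProduct hL.cubic hR.cubic hD hg.adj_left hg.adj_right hi
  have hcut := BoldGadget.hasOnlyTrivialThreeCuts_dotProduct hL.hasOnlyTrivialThreeCuts
    hR.hasOnlyTrivialThreeCuts hL.cubic hR.cubic hD hab hcd hi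
  have hgirth := BoldGadget.five_le_egirth_dotProduct hL.girth hR.girth hD
    ⟨hab, hi.1, hi.2.1, hi.2.2.1, hi.2.2.2, hcd⟩
  have : Nonempty (({x, y}ᶜ : Set V) ⊕ W) := ⟨Sum.inr a⟩
  refine ⟨⟨hcut.connected h3, h3, fun e _ => hcut.not_isBridge h3 e,
    hcut.isCyclicallyEdgeConnected, ?_, hgirth⟩, hodd⟩
  exact SimpleGraph.chromaticNumber_eq_iff_colorable_not_colorable.2
    ⟨BoldGadget.colorable_four_lineGraph h3 hcut hgirth,
      BoldGadget.not_colorable_three_lineGraph h3 hodd⟩
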